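/- **Definitions.** A polygon is a two-dimensional convex polygon $\Delta\subset\mathbb{R}^2$ with vertices in $\mathbb{Z}^2$; it is $h$-transverse if each of its edges has an outward normal vector of the form $(0,\pm1)$ or $(\pm1,n)$ with $n\in\mathbb{Z}$. For such $\Delta$ let $a(\Delta)$ be its height (maximal minus minimal ordinate), $e^{+\infty}(\Delta)$ and $e^{-\infty}(\Delta)$ the lengths of its top and bottom horizontal edges ($0$ if there is none), $y(\Delta)=|\partial\Delta\cap\mathbb{Z}^2|$, and $b_{\mathrm{left}}(\Delta)$ (resp. $b_{\mathrm{right}}(\Delta)$) the multiset in which $k\in\mathbb{Z}$ appears as often as the integral length of the side with outward normal $(-1,k)$ (resp. $(1,k)$). An oriented graph has vertices, bounded oriented edges (adjacent to two vertices) and infinite oriented edges (adjacent to one vertex): sources, oriented toward their vertex, and sinks, oriented away from it. A floor diagram $\mathcal D$ with Newton polygon $\Delta$ and genus $g\in\mathbb{N}$ is a finite connected acyclic oriented graph with first Betti number $g$, with $a(\Delta)$ vertices, $e^{+\infty}(\Delta)$ sinks and $e^{-\infty}(\Delta)$ sources, with edge weights $w(e)\in\mathbb{N}^*$ equal to $1$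 on infinite edges, and with bijections $L$ and $R$ from the set of vertices to $b_{\mathrm{left}}(\Delta)$ and $b_{\mathrm{right}}(\Delta)$ such that at every vertex $v$ the sum of the entering weights minus the sum of the leaving weights is $L(v)+R(v)$. It has $n=y(\Delta)-1+g$ elements (vertices and edges). A marking is a bijection $m$ from the set of elements to $\{1,\dots,n\}$ that is increasing for the partial order given by oriented paths. An isomorphism of marked floor diagrams is an isomorphism of weighted oriented graphs that preserves $L$, $R$ and $m$. A pairing of order $s$ of $\{1,\dots,n\}$ is a set $S$ of $s$ pairwise disjoint pairs $\{i,i+1\}\subset\{1,\dots,n\}$. A marking $m$ is compatible with $S$ if for each $\alpha\in S$ the set $m^{-1}(\alpha)$ consists of an edge and an adjacent vertex, or of two edges both entering or both leaving a same vertex. Put $[k]=\frac{q^{k/2}-q^{-k/2}}{q^{1/2}-q^{-1/2}}$ and $[k]_2=[k](q^2)$. The refined $S$-multiplicity $\mu_S(\mathcal D,m)$ is $0$ if $m$ is not compatible with $S$, and otherwise $$\mu_S(\mathcal D,m)=\prod_{e\in E_0}[w(e)]^2\prod_{e\in E_1}[w(e)]_2\prod_{\{e,e'\}\in E_2}\frac{[w(e)][w(e')][w(e)+w(e')]}{[2]},$$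 where $E_0$ is the set of edges lying in no $m^{-1}(\alpha)$, $\alpha\in S$, $E_1$ the set of edges $e$ with $m^{-1}(\alpha)=\{e,v\}$ for some $\alpha\in S$ and some vertex $v$, and $E_2$ the set of pairs of edges of the form $m^{-1}(\alpha)$, $\alpha\in S$. Let $$G_g(\Delta,S)=\sum_{(\mathcal D,m)}\mu_S(\mathcal D,m),$$ the sum running over the isomorphism classes of marked floor diagrams with Newton polygon $\Delta$ and genus $g$. **Theorem.** Let $\Delta$ be an $h$-transverse polygon, let $g,s\in\mathbb{N}$, and let $S,S'$ be two pairings of order $s$ of $\{1,\dots,y(\Delta)-1+g\}$. Then there are only finitely many isomorphism classes of marked floor diagrams with Newton polygon $\Delta$ and genus $g$, the sum $G_g(\Delta,S)$ is a Laurent polynomial in $\mathbb{Z}[q^{\pm1}]$, and $$G_g(\Delta,S)=G_g(\Delta,S').$$ Hence $G_g(\Delta,S)$ depends only on $\Delta$, $g$ and $s$; it is denoted $G_g(\Delta,s)$ and called the Göttsche–Schroeter invariant of genus $g$. -/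

import Mathlib

noncomputable section

namespace FloorDiagrams

open scoped Classical

/-! ### Lattice polygons in the plane -/

/-- The lattice `ℤ²` inside `ℝ²`. -/
def lattice : Set (ℝ × ℝ) := Set.range fun p : ℤ × ℤ => ((p.1 : ℝ), (p.2 : ℝ))

/-- A convex polygon (with non-empty interior) whose vertices are lattice points. -/
def IsLatticePolygon (Δ : Set (ℝ × ℝ)) : Prop :=
  (∃ A : Finset (ℝ × ℝ), (A : Set (ℝ × ℝ)) ⊆ lattice ∧ Δ = convexHull ℝ (A : Set (ℝ × ℝ))) ∧
    (interior Δ).Nonempty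

/-- The face of `Δ` on which the linear form `⟨u, ·⟩` is maximal. For `u ≠ 0` it is the edge of `Δ`
with outward normal vector `u` if there is such an edge, and a single vertex otherwise. -/
def face (Δ : Set (ℝ × ℝ)) (u : ℝ × ℝ) : Set (ℝ × ℝ) :=
  {p ∈ Δ | ∀ p' ∈ Δ, u.1 * p'.1 + u.2 * p'.2 ≤ u.1 * p.1 + u.2 * p.2}

/-- A lattice polygon is h-transverse if each of its edges has an outward normal vector of the form
`(0, ±1)` or `(±1, n)` with `n` an integer. -/
def IsHTransverse (Δ : Set (ℝ × ℝ)) : Prop :=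
  IsLatticePolygon Δ ∧
    ∀ u : ℝ × ℝ, u ≠ 0 → (face Δ u).Nontrivial →
      ∃ c : ℝ, 0 < c ∧
        (c • u = (0, 1) ∨ c • u = (0, -1) ∨
          ∃ n : ℤ, c • u = (1, (n : ℝ)) ∨ c • u = (-1, (n : ℝ)))

/-- The integral length of a segment (possibly reduced to a point) with lattice end points. -/
def latticeLength (F : Set (ℝ × ℝ)) : ℕ := (F ∩ lattice).ncard - 1

/-- The height `a(Δ)`: difference between the maximal and the minimal ordinate of a point. -/
def height (Δ : Set (ℝ × ℝ)) : ℝ := sSup (Prod.snd '' Δ) - sInf (Prod.snd '' Δ)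

/-- The length of the top horizontal edge (`0` if there is none). -/
def topLength (Δ : Set (ℝ × ℝ)) : ℕ := latticeLength (face Δ (0, 1))

/-- The length of the bottom horizontal edge (`0` if there is none). -/
def bottomLength (Δ : Set (ℝ × ℝ)) : ℕ := latticeLength (face Δ (0, -1))

/-- The unordered list `b_left(Δ)`, given by the multiplicity of each integer `k` in it: the
integral length of the side with outward normal vector `(-1, k)`. -/
def bLeft (Δ : Set (ℝ × ℝ)) (k : ℤ) : ℕ := latticeLength (face Δ (-1, (k : ℝ)))

/-- The unordered list `b_right(Δ)`, given by the multiplicity of each integer `k` in it: the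
integral length of the side with outward normal vector `(1, k)`. -/
def bRight (Δ : Set (ℝ × ℝ)) (k : ℤ) : ℕ := latticeLength (face Δ (1, (k : ℝ)))

/-- The number `y(Δ)` of lattice points on the boundary. -/
def boundaryPoints (Δ : Set (ℝ × ℝ)) : ℕ := (frontier Δ ∩ lattice).ncard

/-! ### Weighted oriented graphs with infinite edges -/

/-- A finite weighted oriented graph. An edge with `src e = none` is a source (infinite edge
oriented toward its unique vertex), an edge with `tgt e = none` is a sink (infinite edge oriented
from its unique vertex); the other edges are bounded. -/
structure WGraph where
  V : Type
  E : Type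
  [fintypeV : Fintype V]
  [fintypeE : Fintype E]
  src : E → Option V
  tgt : E → Option V
  adjacent : ∀ e, src e ≠ none ∨ tgt e ≠ none
  w : E → ℕ
  w_pos : ∀ e, 0 < w e

attribute [instance] WGraph.fintypeV WGraph.fintypeE

namespace WGraph

variable (Γ : WGraph)

/-- The elements of the graph: its vertices and its edges. -/
abbrev Elt : Type := Γ.V ⊕ Γ.E

/-- The sources. -/
def sources : Finset Γ.E := Finset.univ.filter fun e => Γ.src e = none

/-- The sinks. -/
def sinks : Finset Γ.E := Finset.univ.filter fun e => Γ.tgt e = none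

/-- The bounded edges. -/
def boundedEdges : Finset Γ.E := Finset.univ.filter fun e => Γ.src e ≠ none ∧ Γ.tgt e ≠ none

/-- The number of elements. -/
def numElts : ℕ := Fintype.card Γ.V + Fintype.card Γ.E

/-- The divergence of a vertex: entering weights minus leaving weights. -/
def div (v : Γ.V) : ℤ :=
  (∑ e ∈ Finset.univ.filter (fun e => Γ.tgt e = some v), (Γ.w e : ℤ)) -
    ∑ e ∈ Finset.univ.filter (fun e => Γ.src e = some v), (Γ.w e : ℤ)

/-- One step along the orientation, from an edge to the vertex it enters or from a vertex to an
edge leaving it. -/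
inductive Step : Γ.Elt → Γ.Elt → Prop
  | enter (e : Γ.E) (v : Γ.V) (h : Γ.tgt e = some v) : Step (Sum.inr e) (Sum.inl v)
  | leave (v : Γ.V) (e : Γ.E) (h : Γ.src e = some v) : Step (Sum.inl v) (Sum.inr e)

/-- `x ≺ y`: there is a (non-trivial) oriented path from `x` to `y`. -/
def Prec : Γ.Elt → Γ.Elt → Prop := Relation.TransGen Γ.Step

/-- There is no oriented cycle. -/
def IsAcyclic : Prop := ∀ x : Γ.Elt, ¬ Γ.Prec x x

/-- The adjacency graph of the vertices, forgetting orientations and multiplicities of edges. -/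
def underlying : SimpleGraph Γ.V :=
  SimpleGraph.fromRel fun u v => ∃ e, Γ.src e = some u ∧ Γ.tgt e = some v

/-- The graph is connected. -/
def IsConnected : Prop := Γ.underlying.Connected

/-- The first Betti number: bounded edges minus vertices plus connected components (infinite edges
are contractible and contribute nothing). -/
def genus : ℤ :=
  (Γ.boundedEdges.card : ℤ) - (Fintype.card Γ.V : ℤ) +
    (Nat.card Γ.underlying.ConnectedComponent : ℤ)

end WGraph

/-! ### Floor diagrams and markings -/

/-- A floor diagram with Newton polygon `Δ` and genus `g`. The maps `L` and `R` are bijections from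
the vertices to the unordered lists `b_left(Δ)` and `b_right(Δ)`: each integer is taken exactly as
many times as it appears in the list. -/
structure FloorDiagram (Δ : Set (ℝ × ℝ)) (g : ℕ) extends WGraph where
  connected : toWGraph.IsConnected
  acyclic : toWGraph.IsAcyclic
  genus_eq : toWGraph.genus = (g : ℤ)
  card_vertices : (Fintype.card V : ℝ) = height Δ
  card_sinks : toWGraph.sinks.card = topLength Δ
  card_sources : toWGraph.sources.card = bottomLength Δ
  weight_infinite : ∀ e, src e = none ∨ tgt e = none → w e = 1
  L : V → ℤ
  R : V → ℤ
  L_bij : ∀ k : ℤ, (Finset.univ.filter fun v => L v = k).card = bLeft Δ k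
  R_bij : ∀ k : ℤ, (Finset.univ.filter fun v => R v = k).card = bRight Δ k
  div_eq : ∀ v, toWGraph.div v = L v + R v

/-- A marked floor diagram: a floor diagram with an increasing bijection from its elements to
`{1, …, n}`, where `n` is the number of elements. -/
structure MarkedFloorDiagram (Δ : Set (ℝ × ℝ)) (g : ℕ) extends FloorDiagram Δ g where
  m : V ⊕ E → ℕ
  m_bij : Set.BijOn m Set.univ (Set.Icc 1 toWGraph.numElts)
  m_increasing : ∀ x y, toWGraph.Prec x y → m x < m y

namespace MarkedFloorDiagram

variable {Δ : Set (ℝ × ℝ)} {g : ℕ}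

/-- Isomorphisms of marked floor diagrams. -/
structure Iso (D D' : MarkedFloorDiagram Δ g) where
  onV : D.V ≃ D'.V
  onE : D.E ≃ D'.E
  src_eq : ∀ e, D'.src (onE e) = (D.src e).map onV
  tgt_eq : ∀ e, D'.tgt (onE e) = (D.tgt e).map onV
  w_eq : ∀ e, D'.w (onE e) = D.w e
  L_eq : ∀ v, D'.L (onV v) = D.L v
  R_eq : ∀ v, D'.R (onV v) = D.R v
  m_eq : ∀ x, D'.m (Equiv.sumCongr onV onE x) = D.m x

/-- Being isomorphic. -/
def IsIso (D D' : MarkedFloorDiagram Δ g) : Prop := Nonempty (Iso D D')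

/-- The set `m⁻¹(α)`. -/
def fiber (D : MarkedFloorDiagram Δ g) (α : Finset ℕ) : Set (D.V ⊕ D.E) := {x | D.m x ∈ α}

/-- The marking is compatible with `S`: each `m⁻¹(α)`, `α ∈ S`, consists of an edge and an adjacent
vertex, or of two edges both entering or both leaving the same vertex. -/
def Compatible (D : MarkedFloorDiagram Δ g) (S : Finset (Finset ℕ)) : Prop :=
  ∀ α ∈ S,
    (∃ (e : D.E) (v : D.V), D.fiber α = {Sum.inr e, Sum.inl v} ∧
      (D.src e = some v ∨ D.tgt e = some v)) ∨
    (∃ (e e' : D.E) (v : D.V), e ≠ e' ∧ D.fiber α = {Sum.inr e, Sum.inr e'} ∧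
      ((D.tgt e = some v ∧ D.tgt e' = some v) ∨ (D.src e = some v ∧ D.src e' = some v)))

/-- The unpaired edges. -/
def E₀ (D : MarkedFloorDiagram Δ g) (S : Finset (Finset ℕ)) : Finset D.E :=
  Finset.univ.filter fun e => ∀ α ∈ S, Sum.inr e ∉ D.fiber α

/-- The edges paired with a vertex. -/
def E₁ (D : MarkedFloorDiagram Δ g) (S : Finset (Finset ℕ)) : Finset D.E :=
  Finset.univ.filter fun e => ∃ v, ∃ α ∈ S, ({Sum.inr e, Sum.inl v} : Set (D.V ⊕ D.E)) = D.fiber α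

/-- The pairs of edges that are paired together. -/
def E₂ (D : MarkedFloorDiagram Δ g) (S : Finset (Finset ℕ)) : Finset (Finset D.E) :=
  Finset.univ.filter fun P => P.card = 2 ∧
    ∃ α ∈ S, (Sum.inr '' (P : Set D.E) : Set (D.V ⊕ D.E)) = D.fiber α

end MarkedFloorDiagram

/-! ### Pairings, quantum integers and refined multiplicities -/

/-- `S` is a pairing of order `s` of `{1, …, n}`: a set of `s` disjoint pairs `{i, i + 1}`
contained in `{1, …, n}`. -/
def IsPairing (n s : ℕ) (S : Finset (Finset ℕ)) : Prop :=
  S.card = s ∧ (∀ α ∈ S, ∃ i, 1 ≤ i ∧ i + 1 ≤ n ∧ α = {i, i + 1}) ∧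
    ∀ α ∈ S, ∀ β ∈ S, α ≠ β → Disjoint α β

/-- The variable `q^{1/2}`, as the indeterminate of a field of rational functions. -/
def qHalf : RatFunc ℚ := RatFunc.X

/-- The ring `ℤ[q, q⁻¹]` of Laurent polynomials in `q`. -/
def laurentQ : Subalgebra ℤ (RatFunc ℚ) := Algebra.adjoin ℤ {qHalf ^ 2, (qHalf ^ 2)⁻¹}

/-- The quantum integer `[n](t²) = (tⁿ - t⁻ⁿ) / (t - t⁻¹)`, so that `t` is the square root of the
argument. -/
def quantumAt (t : RatFunc ℚ) (n : ℤ) : RatFunc ℚ := (t ^ n - t ^ (-n)) / (t - t⁻¹)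

/-- The quantum integer `[n] = [n](q)`. -/
def quantum (n : ℤ) : RatFunc ℚ := quantumAt qHalf n

/-- The quantum integer `[n]₂ = [n](q²)`. -/
def quantum₂ (n : ℤ) : RatFunc ℚ := quantumAt (qHalf ^ 2) n

namespace MarkedFloorDiagram

variable {Δ : Set (ℝ × ℝ)} {g : ℕ}

/-- The refined `S`-multiplicity. For `P = {e, e'}` the last factor is
`[w(e)] [w(e')] [w(e) + w(e')] / [2]`. -/
def mult (S : Finset (Finset ℕ)) (D : MarkedFloorDiagram Δ g) : RatFunc ℚ :=
  if D.Compatible S then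
    (∏ e ∈ D.E₀ S, quantum (D.w e) ^ 2) * (∏ e ∈ D.E₁ S, quantum₂ (D.w e)) *
      ∏ P ∈ D.E₂ S, (∏ e ∈ P, quantum (D.w e)) * quantum (∑ e ∈ P, (D.w e : ℤ)) / quantum 2
  else 0

/-- The inverse of an isomorphism. -/
def Iso.symm {D D' : MarkedFloorDiagram Δ g} (φ : Iso D D') : Iso D' D where
  onV := φ.onV.symm
  onE := φ.onE.symm
  src_eq e := by
    have := φ.src_eq (φ.onE.symm e)
    rw [Equiv.apply_symm_apply] at this
    simp [this, Option.map_map]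
  tgt_eq e := by
    have := φ.tgt_eq (φ.onE.symm e)
    rw [Equiv.apply_symm_apply] at this
    simp [this, Option.map_map]
  w_eq e := by simpa using (φ.w_eq (φ.onE.symm e)).symm
  L_eq v := by simpa using (φ.L_eq (φ.onV.symm v)).symm
  R_eq v := by simpa using (φ.R_eq (φ.onV.symm v)).symm
  m_eq x := by
    have := φ.m_eq ((Equiv.sumCongr φ.onV φ.onE).symm x)
    rw [Equiv.apply_symm_apply] at this
    rw [this]; rfl

/-- Isomorphism of marked floor diagrams is an equivalence relation. -/
instance isoSetoid (Δ : Set (ℝ × ℝ)) (g : ℕ) : Setoid (MarkedFloorDiagram Δ g) where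
  r := IsIso
  iseqv :=
    { refl := fun D => ⟨⟨Equiv.refl _, Equiv.refl _, by simp, by simp, by simp, by simp, by simp,
        by simp⟩⟩
      symm := fun ⟨φ⟩ => ⟨φ.symm⟩
      trans := fun ⟨φ⟩ ⟨ψ⟩ =>
        ⟨⟨φ.onV.trans ψ.onV, φ.onE.trans ψ.onE,
          fun e => by simp [ψ.src_eq, φ.src_eq, Option.map_map],
          fun e => by simp [ψ.tgt_eq, φ.tgt_eq, Option.map_map],
          fun e => by simp [ψ.w_eq, φ.w_eq],
          fun v => by simp [ψ.L_eq, φ.L_eq],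
          fun v => by simp [ψ.R_eq, φ.R_eq],
          fun x => by
            rw [← φ.m_eq, ← ψ.m_eq]
            cases x <;> rfl⟩⟩ }

theorem Iso.fiber_eq {D D' : MarkedFloorDiagram Δ g} (φ : Iso D D') (α : Finset ℕ) :
    D'.fiber α = Equiv.sumCongr φ.onV φ.onE '' D.fiber α := by
  ext x
  constructor
  · intro hx
    refine ⟨(Equiv.sumCongr φ.onV φ.onE).symm x, ?_, Equiv.apply_symm_apply _ _⟩
    have := φ.m_eq ((Equiv.sumCongr φ.onV φ.onE).symm x)
    rw [Equiv.apply_symm_apply] at this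
    change D.m _ ∈ α
    rw [← this]
    exact hx
  · rintro ⟨y, hy, rfl⟩
    change D'.m _ ∈ α
    rw [φ.m_eq]
    exact hy

theorem Iso.compatible {D D' : MarkedFloorDiagram Δ g} (φ : Iso D D') {S : Finset (Finset ℕ)}
    (h : D.Compatible S) : D'.Compatible S := by
  intro α hα
  rcases h α hα with ⟨e, v, h1, h2⟩ | ⟨e, e', v, hne, h1, h2⟩
  · refine Or.inl ⟨φ.onE e, φ.onV v, ?_, ?_⟩
    · rw [φ.fiber_eq, h1, Set.image_pair]; rfl
    · rw [φ.src_eq, φ.tgt_eq]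
      rcases h2 with h2 | h2 <;> simp [h2]
  · refine Or.inr ⟨φ.onE e, φ.onE e', φ.onV v, fun h => hne (φ.onE.injective h), ?_, ?_⟩
    · rw [φ.fiber_eq, h1, Set.image_pair]; rfl
    · rw [φ.src_eq, φ.tgt_eq, φ.src_eq, φ.tgt_eq]
      rcases h2 with ⟨h2, h3⟩ | ⟨h2, h3⟩ <;> simp [h2, h3]

theorem Iso.mem_E₀ {D D' : MarkedFloorDiagram Δ g} (φ : Iso D D') (S : Finset (Finset ℕ))
    (e : D.E) : e ∈ D.E₀ S ↔ φ.onE e ∈ D'.E₀ S := by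
  have h : D'.m (Sum.inr (φ.onE e)) = D.m (Sum.inr e) := φ.m_eq (Sum.inr e)
  simp only [E₀, Finset.mem_filter, Finset.mem_univ, true_and]
  change (∀ α ∈ S, ¬ D.m (Sum.inr e) ∈ α) ↔ ∀ α ∈ S, ¬ D'.m (Sum.inr (φ.onE e)) ∈ α
  rw [h]

theorem Iso.mem_E₁ {D D' : MarkedFloorDiagram Δ g} (φ : Iso D D') (S : Finset (Finset ℕ))
    (e : D.E) (h : e ∈ D.E₁ S) : φ.onE e ∈ D'.E₁ S := by
  simp only [E₁, Finset.mem_filter, Finset.mem_univ, true_and] at h ⊢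
  obtain ⟨v, α, hα, h⟩ := h
  refine ⟨φ.onV v, α, hα, ?_⟩
  rw [φ.fiber_eq, ← h, Set.image_pair]; rfl

theorem Iso.mem_E₂ {D D' : MarkedFloorDiagram Δ g} (φ : Iso D D') (S : Finset (Finset ℕ))
    (P : Finset D.E) (h : P ∈ D.E₂ S) : P.map φ.onE.toEmbedding ∈ D'.E₂ S := by
  simp only [E₂, Finset.mem_filter, Finset.mem_univ, true_and, Finset.card_map] at h ⊢
  obtain ⟨hc, α, hα, h⟩ := h
  refine ⟨hc, α, hα, ?_⟩
  rw [φ.fiber_eq, ← h, Finset.coe_map, Set.image_image, Set.image_image]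
  rfl

/-- The refined multiplicity only depends on the isomorphism class. -/
theorem Iso.mult_eq {D D' : MarkedFloorDiagram Δ g} (φ : Iso D D') (S : Finset (Finset ℕ)) :
    mult S D = mult S D' := by
  by_cases h : D.Compatible S
  · have h' := φ.compatible h
    rw [mult, mult, if_pos h, if_pos h']
    congr 1
    · congr 1
      · exact Finset.prod_equiv φ.onE (φ.mem_E₀ S) fun e _ => by rw [φ.w_eq]
      · refine Finset.prod_equiv φ.onE (fun e => ⟨φ.mem_E₁ S e, fun he => ?_⟩)
          fun e _ => by rw [φ.w_eq]
        simpa [Iso.symm] using φ.symm.mem_E₁ S _ he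
    · refine Finset.prod_equiv (Equiv.finsetCongr φ.onE)
        (fun P => ⟨φ.mem_E₂ S P, fun hP => ?_⟩) fun P _ => ?_
      · have := φ.symm.mem_E₂ S _ hP
        convert this using 1
        ext x
        simp [Iso.symm]
      · simp [φ.w_eq]
  · have h' : ¬ D'.Compatible S := fun h' => h (φ.symm.compatible h')
    rw [mult, mult, if_neg h, if_neg h']

end MarkedFloorDiagram

/-- Isomorphism classes of marked floor diagrams with Newton polygon `Δ` and genus `g`. -/
def MarkedClass (Δ : Set (ℝ × ℝ)) (g : ℕ) : Type 1 :=
  Quotient (MarkedFloorDiagram.isoSetoid Δ g)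

/-- The refined `S`-multiplicity of an isomorphism class of marked floor diagrams. -/
def MarkedClass.mult {Δ : Set (ℝ × ℝ)} {g : ℕ} (S : Finset (Finset ℕ)) :
    MarkedClass Δ g → RatFunc ℚ :=
  Quotient.lift (MarkedFloorDiagram.mult S) fun _ _ ⟨φ⟩ => φ.mult_eq S

/-- `G_g(Δ, S)`: the sum of the refined `S`-multiplicities over all isomorphism classes of marked
floor diagrams with Newton polygon `Δ` and genus `g`. -/
def G (g : ℕ) (Δ : Set (ℝ × ℝ)) (S : Finset (Finset ℕ)) : RatFunc ℚ :=
  ∑ᶠ c : MarkedClass Δ g, c.mult S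

end FloorDiagrams

end

noncomputable section

namespace FloorDiagrams

open scoped Classical

/-! The pairings of order `s` are connected by elementary moves replacing a pair `{i, i+1}` by
`{i+1, i+2}` when the other pairs avoid these three positions: moving pairs to the left ends at the
pairs starting at `1, 3, …, 2s - 1` (`eq_oddSet_of_invariant`). So it suffices to see that one
elementary move does not change the sum. A marked floor diagram is recorded up to isomorphism by its
code, the sequence of labels read along the marking; the codes form a finite set, and the
multiplicity becomes a product of local factors, which is zero by itself when the marking is
incompatible (`mult_eq_code_mult`).

The `defect` of a code is the change of its multiplicity under the move. The sum of the defects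
vanishes (`sum_defect`), by cases on the adjacencies between the elements at `i`, `i+1`, `i+2`: - no
adjacency: exchanging the outer two changes the sign of the defect; - two edges entering, or two
leaving, a vertex of the triple: exchanging them cancels the defects, by `2[a][b][a+b]/[2] =
[a]²[b]₂ + [b]²[a]₂` (`two_mul_edgePair`); - one edge `e` adjacent to a vertex `v`, and a third
element `x` adjacent to neither: the defects of the three orders with `e` and `v` in their forced
order add up to twice, up to sign, the factor of `{e, x}`, nonzero only if `x` is an edge that
starts or ends with `e` at the far end of `e`; - an edge of weight `a` entering a vertex and an edge
of weight `b` leaving it: the defect is a multiple of `[a]₂[b]² - [b]₂[a]²`. It vanishes for `a =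
b`.

The last two cases cancel each other. If `b < a`, the origin of the outgoing edge can slide back
along the incoming one, which keeps weight `a - b`; this is a bijection onto the configurations left
over from the third case for an edge entering `v`, and `two_mul_edgePair_add` matches the terms. The
case `a < b` is symmetric, with the end of the incoming edge sliding forwards. Sliding preserves
divergences, connectedness and the order of the marking.

Integrality holds factor by factor: squares `[w]²` involve only integral powers of `q`, and one of
`a`, `b`, `a + b` is even, which absorbs the denominator `[2]`. -/

/-! ### Codes of marked floor diagrams -/

/-- What a marking puts at a position: nothing, a vertex with its values of `L` and `R`, or an edge
with the positions of its end points and its weight. -/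
inductive Label where
  | out
  | vertex (l r : ℤ)
  | edge (s t : Option ℕ) (w : ℕ)

/-- A code attaches a label to each position. -/
abbrev Code := ℕ → Label

namespace MarkedFloorDiagram

variable {Δ : Set (ℝ × ℝ)} {g : ℕ}

/-- The position of a vertex. -/
def pos (D : MarkedFloorDiagram Δ g) (v : D.V) : ℕ := D.m (Sum.inl v)

/-- The label of an element. -/
def label (D : MarkedFloorDiagram Δ g) : D.V ⊕ D.E → Label
  | Sum.inl v => .vertex (D.L v) (D.R v)
  | Sum.inr e => .edge ((D.src e).map D.pos) ((D.tgt e).map D.pos) (D.w e)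

/-- The code of a marked floor diagram. -/
def code (D : MarkedFloorDiagram Δ g) : Code := fun k =>
  if h : ∃ x, D.m x = k then D.label h.choose else .out

theorem m_injective (D : MarkedFloorDiagram Δ g) : Function.Injective D.m :=
  Set.injOn_univ.1 D.m_bij.injOn

theorem m_mem (D : MarkedFloorDiagram Δ g) (x : D.V ⊕ D.E) :
    D.m x ∈ Set.Icc 1 D.numElts := D.m_bij.mapsTo (Set.mem_univ x)

theorem exists_m_eq (D : MarkedFloorDiagram Δ g) {k : ℕ} (hk : k ∈ Set.Icc 1 D.numElts) :
    ∃ x, D.m x = k := by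
  obtain ⟨x, -, hx⟩ := D.m_bij.surjOn hk
  exact ⟨x, hx⟩

theorem pos_injective (D : MarkedFloorDiagram Δ g) : Function.Injective D.pos :=
  fun _ _ h => Sum.inl_injective (D.m_injective h)

theorem code_m (D : MarkedFloorDiagram Δ g) (x : D.V ⊕ D.E) : D.code (D.m x) = D.label x := by
  have h : ∃ y, D.m y = D.m x := ⟨x, rfl⟩
  rw [code, dif_pos h, D.m_injective h.choose_spec]

theorem code_pos (D : MarkedFloorDiagram Δ g) (v : D.V) :
    D.code (D.pos v) = .vertex (D.L v) (D.R v) := D.code_m (Sum.inl v)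

theorem code_inr (D : MarkedFloorDiagram Δ g) (e : D.E) :
    D.code (D.m (Sum.inr e)) = .edge ((D.src e).map D.pos) ((D.tgt e).map D.pos) (D.w e) :=
  D.code_m (Sum.inr e)

theorem code_eq_out_iff (D : MarkedFloorDiagram Δ g) (k : ℕ) :
    D.code k = .out ↔ k ∉ Set.Icc 1 D.numElts := by
  constructor
  · intro h hk
    obtain ⟨x, rfl⟩ := D.exists_m_eq hk
    rw [code_m] at h
    cases x <;> simp [label] at h
  · intro hk
    rw [code, dif_neg]
    rintro ⟨x, rfl⟩
    exact hk (D.m_mem x)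

theorem code_eq_vertex (D : MarkedFloorDiagram Δ g) {k : ℕ} {l r : ℤ}
    (h : D.code k = .vertex l r) : ∃ v, D.pos v = k ∧ D.L v = l ∧ D.R v = r := by
  have hk : k ∈ Set.Icc 1 D.numElts := by
    by_contra hk
    rw [(D.code_eq_out_iff k).2 hk] at h
    simp at h
  obtain ⟨x | x, rfl⟩ := D.exists_m_eq hk
  · rw [code_m] at h
    simp only [label, Label.vertex.injEq] at h
    exact ⟨x, rfl, h⟩
  · rw [code_m] at h
    simp [label] at h

theorem code_eq_edge (D : MarkedFloorDiagram Δ g) {k : ℕ} {s t : Option ℕ} {w : ℕ}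
    (h : D.code k = .edge s t w) :
    ∃ e, D.m (Sum.inr e) = k ∧ (D.src e).map D.pos = s ∧ (D.tgt e).map D.pos = t ∧ D.w e = w := by
  have hk : k ∈ Set.Icc 1 D.numElts := by
    by_contra hk
    rw [(D.code_eq_out_iff k).2 hk] at h
    simp at h
  obtain ⟨x | x, rfl⟩ := D.exists_m_eq hk
  · rw [code_m] at h
    simp [label] at h
  · rw [code_m] at h
    simp only [label, Label.edge.injEq] at h
    exact ⟨x, rfl, h⟩

/-- A code is the code of `D` once it has the right labels. -/
theorem code_eq_of_label (D : MarkedFloorDiagram Δ g) (c : Code)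
    (h : ∀ x, c (D.m x) = D.label x) (h' : ∀ k, k ∉ Set.Icc 1 D.numElts → c k = .out) :
    D.code = c := by
  funext k
  by_cases hk : k ∈ Set.Icc 1 D.numElts
  · obtain ⟨x, rfl⟩ := D.exists_m_eq hk
    rw [code_m, h]
  · rw [h' k hk, code_eq_out_iff]
    exact hk

theorem Iso.code_eq {D D' : MarkedFloorDiagram Δ g} (φ : Iso D D') : D.code = D'.code := by
  have hpos : ∀ v, D'.pos (φ.onV v) = D.pos v := fun v => φ.m_eq (Sum.inl v)
  have hE : ∀ e, D'.m (Sum.inr (φ.onE e)) = D.m (Sum.inr e) := fun e => φ.m_eq (Sum.inr e)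
  have hn : D.numElts = D'.numElts := by
    unfold WGraph.numElts
    rw [Fintype.card_congr φ.onV, Fintype.card_congr φ.onE]
  apply code_eq_of_label
  · rintro (v | e)
    · change D'.code (D.pos v) = _
      rw [← hpos, code_pos, φ.L_eq, φ.R_eq]
      rfl
    · rw [← hE, code_inr, φ.src_eq, φ.tgt_eq, φ.w_eq]
      simp only [label, Option.map_map, Function.comp_def, hpos]
  · intro k hk
    rw [code_eq_out_iff, ← hn]
    exact hk

/-- A marking is injective, so an element is determined by its position. Sending each element to the
one at the same position is thus bijective, and the labels say that it respects the whole structure.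
-/
theorem isIso_of_code_eq {D D' : MarkedFloorDiagram Δ g} (h : D.code = D'.code) : IsIso D D' := by
  have hV : ∀ v : D.V, ∃ v' : D'.V, D'.pos v' = D.pos v ∧ D'.L v' = D.L v ∧ D'.R v' = D.R v :=
    fun v => D'.code_eq_vertex (by rw [← h, code_pos])
  have hV' : ∀ v' : D'.V, ∃ v : D.V, D.pos v = D'.pos v' ∧ D.L v = D'.L v' ∧ D.R v = D'.R v' :=
    fun v => D.code_eq_vertex (by rw [h, code_pos])
  have hE : ∀ e : D.E, ∃ e' : D'.E, D'.m (Sum.inr e') = D.m (Sum.inr e) ∧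
      (D'.src e').map D'.pos = (D.src e).map D.pos ∧
      (D'.tgt e').map D'.pos = (D.tgt e).map D.pos ∧ D'.w e' = D.w e :=
    fun e => D'.code_eq_edge (by rw [← h, code_inr])
  have hE' : ∀ e' : D'.E, ∃ e : D.E, D.m (Sum.inr e) = D'.m (Sum.inr e') ∧
      (D.src e).map D.pos = (D'.src e').map D'.pos ∧
      (D.tgt e).map D.pos = (D'.tgt e').map D'.pos ∧ D.w e = D'.w e' :=
    fun e => D.code_eq_edge (by rw [h, code_inr])
  choose f hf hfL hfR using hV
  choose f' hf' _ _ using hV'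
  choose p hp hps hpt hpw using hE
  choose p' hp' _ _ _ using hE'
  let φV : D.V ≃ D'.V := ⟨f, f', fun v => D.pos_injective (by rw [hf', hf]),
    fun v => D'.pos_injective (by rw [hf, hf'])⟩
  let φE : D.E ≃ D'.E := ⟨p, p', fun e => Sum.inr_injective (D.m_injective (by rw [hp', hp])),
    fun e => Sum.inr_injective (D'.m_injective (by rw [hp, hp']))⟩
  have key : ∀ (o : Option D.V) (o' : Option D'.V), o'.map D'.pos = o.map D.pos →
      o' = o.map f := by
    intro o o' ho
    have : (o.map f).map D'.pos = o.map D.pos := by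
      rw [Option.map_map]
      exact congrArg (fun F => Option.map F o) (funext hf)
    exact Option.map_injective D'.pos_injective (ho.trans this.symm)
  refine ⟨⟨φV, φE, fun e => key _ _ (hps e), fun e => key _ _ (hpt e), hpw, hfL, hfR, ?_⟩⟩
  rintro (v | e)
  · exact hf v
  · exact hp e

/-! ### Local properties of codes -/

theorem m_lt_of_src (D : MarkedFloorDiagram Δ g) {e : D.E} {v : D.V} (h : D.src e = some v) :
    D.pos v < D.m (Sum.inr e) :=
  D.m_increasing _ _ (Relation.TransGen.single (WGraph.Step.leave v e h))

theorem m_lt_of_tgt (D : MarkedFloorDiagram Δ g) {e : D.E} {v : D.V} (h : D.tgt e = some v) :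
    D.m (Sum.inr e) < D.pos v :=
  D.m_increasing _ _ (Relation.TransGen.single (WGraph.Step.enter e v h))

end MarkedFloorDiagram

/-- The local conditions satisfied by the code of a marked floor diagram. -/
structure Code.WF (c : Code) : Prop where
  src_lt : ∀ {k j t w}, c k = .edge (some j) t w → j < k ∧ ∃ l r, c j = .vertex l r
  lt_tgt : ∀ {k j s w}, c k = .edge s (some j) w → k < j ∧ ∃ l r, c j = .vertex l r
  w_pos : ∀ {k s t w}, c k = .edge s t w → 0 < w
  w_infinite : ∀ {k s t w}, c k = .edge s t w → s = none ∨ t = none → w = 1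

theorem MarkedFloorDiagram.code_wf {Δ : Set (ℝ × ℝ)} {g : ℕ} (D : MarkedFloorDiagram Δ g) :
    D.code.WF where
  src_lt {k j t w} h := by
    obtain ⟨e, rfl, hs, -, -⟩ := D.code_eq_edge h
    obtain ⟨v, hv, rfl⟩ := Option.map_eq_some_iff.1 hs
    exact ⟨D.m_lt_of_src hv, _, _, D.code_pos v⟩
  lt_tgt {k j t w} h := by
    obtain ⟨e, rfl, -, ht, -⟩ := D.code_eq_edge h
    obtain ⟨v, hv, rfl⟩ := Option.map_eq_some_iff.1 ht
    exact ⟨D.m_lt_of_tgt hv, _, _, D.code_pos v⟩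
  w_pos {k s t w} h := by
    obtain ⟨e, rfl, rfl, rfl, rfl⟩ := D.code_eq_edge h
    exact D.w_pos e
  w_infinite {k s t w} h h' := by
    obtain ⟨e, rfl, rfl, rfl, rfl⟩ := D.code_eq_edge h
    exact D.weight_infinite e (by simpa using h')

/-- The set of codes of marked floor diagrams. -/
def codes (Δ : Set (ℝ × ℝ)) (g : ℕ) : Set Code :=
  Set.range (MarkedFloorDiagram.code (Δ := Δ) (g := g))

/-- The code of an isomorphism class. -/
def MarkedClass.code {Δ : Set (ℝ × ℝ)} {g : ℕ} : MarkedClass Δ g → Code :=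
  Quotient.lift MarkedFloorDiagram.code fun _ _ ⟨φ⟩ => φ.code_eq

theorem MarkedClass.code_injective {Δ : Set (ℝ × ℝ)} {g : ℕ} :
    Function.Injective (MarkedClass.code (Δ := Δ) (g := g)) := by
  intro a b
  refine Quotient.inductionOn₂ a b fun D D' h => ?_
  exact Quotient.sound (MarkedFloorDiagram.isIso_of_code_eq h)

theorem MarkedClass.range_code (Δ : Set (ℝ × ℝ)) (g : ℕ) :
    Set.range (MarkedClass.code (Δ := Δ) (g := g)) = codes Δ g := by
  ext c
  constructor
  · rintro ⟨a, rfl⟩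
    refine Quotient.inductionOn a fun D => ⟨D, rfl⟩
  · rintro ⟨D, rfl⟩
    exact ⟨Quotient.mk _ D, rfl⟩

/-! ### The number of elements -/

theorem FloorDiagram.card_pos {Δ : Set (ℝ × ℝ)} {g : ℕ} (D : FloorDiagram Δ g) :
    0 < Fintype.card D.V := by
  have := D.connected.nonempty
  exact Fintype.card_pos

theorem WGraph.IsConnected.card_connectedComponent {Γ : WGraph} (h : Γ.IsConnected) :
    Nat.card Γ.underlying.ConnectedComponent = 1 := by
  have := h.preconnected.subsingleton_connectedComponent
  have : Nonempty Γ.underlying.ConnectedComponent :=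
    h.nonempty.map Γ.underlying.connectedComponentMk
  exact Nat.card_unique

theorem FloorDiagram.card_boundedEdges {Δ : Set (ℝ × ℝ)} {g : ℕ} (D : FloorDiagram Δ g) :
    D.boundedEdges.card + 1 = Fintype.card D.V + g := by
  have h := D.genus_eq
  unfold WGraph.genus at h
  rw [D.connected.card_connectedComponent] at h
  push_cast at h
  omega

theorem WGraph.card_edges (Γ : WGraph) :
    Fintype.card Γ.E = Γ.boundedEdges.card + Γ.sinks.card + Γ.sources.card := by
  have h1 : Disjoint Γ.boundedEdges Γ.sinks := by
    rw [Finset.disjoint_left]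
    simp +contextual [WGraph.boundedEdges, WGraph.sinks]
  have h2 : Disjoint (Γ.boundedEdges ∪ Γ.sinks) Γ.sources := by
    rw [Finset.disjoint_left]
    intro e he hs
    have ha := Γ.adjacent e
    simp only [WGraph.boundedEdges, WGraph.sinks, WGraph.sources, Finset.mem_union,
      Finset.mem_filter, Finset.mem_univ, true_and] at he hs
    tauto
  rw [← Finset.card_union_of_disjoint h1, ← Finset.card_union_of_disjoint h2, ← Finset.card_univ]
  congr 1
  ext e
  simp only [WGraph.boundedEdges, WGraph.sinks, WGraph.sources, Finset.mem_union,
    Finset.mem_filter, Finset.mem_univ, true_and, true_iff]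
  tauto

theorem FloorDiagram.numElts_add_one {Δ : Set (ℝ × ℝ)} {g : ℕ} (D : FloorDiagram Δ g) :
    D.numElts + 1 = 2 * Fintype.card D.V + g + topLength Δ + bottomLength Δ := by
  have h := D.card_boundedEdges
  unfold WGraph.numElts
  rw [D.card_edges, D.card_sinks, D.card_sources]
  omega

theorem FloorDiagram.numElts_eq {Δ : Set (ℝ × ℝ)} {g : ℕ} (D D' : FloorDiagram Δ g) :
    D.numElts = D'.numElts := by
  have h1 := D.numElts_add_one
  have h2 := D'.numElts_add_one
  have h3 : Fintype.card D.V = Fintype.card D'.V := by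
    exact_mod_cast D.card_vertices.trans D'.card_vertices.symm
  omega

/-! ### Finiteness -/

namespace MarkedFloorDiagram

variable {Δ : Set (ℝ × ℝ)} {g : ℕ}

/-- The weights are bounded in terms of the divergences. -/
theorem w_le (D : MarkedFloorDiagram Δ g) (K : ℕ) (hK : ∀ v, -(K : ℤ) ≤ D.L v + D.R v) (e : D.E) :
    D.w e ≤ (D.numElts + K + 1) ^ D.m (Sum.inr e) := by
  generalize hk : D.m (Sum.inr e) = k
  induction k using Nat.strong_induction_on generalizing e with
  | _ k ih =>
    cases hs : D.src e with
    | none =>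
      rw [D.weight_infinite e (Or.inl hs)]
      exact Nat.one_le_pow _ _ (by omega)
    | some v =>
      set B := D.numElts + K + 1 with hB
      have hv : D.pos v < k := hk ▸ D.m_lt_of_src hs
      have hdiv := D.div_eq v
      unfold WGraph.div at hdiv
      have h1 : (D.w e : ℤ) ≤ ∑ e ∈ Finset.univ.filter (fun e => D.src e = some v), (D.w e : ℤ) :=
        Finset.single_le_sum (f := fun e => (D.w e : ℤ)) (fun _ _ => by positivity) (by simp [hs])
      have h2 : ∑ e ∈ Finset.univ.filter (fun e => D.tgt e = some v), (D.w e : ℤ) ≤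
          (D.numElts : ℤ) * (B : ℤ) ^ D.pos v := by
        calc _ ≤ ∑ e ∈ Finset.univ.filter (fun e => D.tgt e = some v), (B : ℤ) ^ D.pos v := by
              refine Finset.sum_le_sum fun e' he' => ?_
              have ht : D.tgt e' = some v := by simpa using he'
              have hlt := D.m_lt_of_tgt ht
              have := ih (D.m (Sum.inr e')) (hlt.trans hv) e' rfl
              calc (D.w e' : ℤ) ≤ (B : ℤ) ^ D.m (Sum.inr e') := by exact_mod_cast this
                _ ≤ _ := pow_le_pow_right₀ (by rw [hB]; push_cast; omega) hlt.le
          _ ≤ _ := by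
              rw [Finset.sum_const, nsmul_eq_mul]
              refine mul_le_mul_of_nonneg_right ?_ (by positivity)
              have := Finset.card_le_univ (Finset.univ.filter (fun e => D.tgt e = some v))
              unfold WGraph.numElts
              exact_mod_cast this.trans (Nat.le_add_left _ _)
      have h3 := hK v
      have h4 : (1 : ℤ) ≤ (B : ℤ) ^ D.pos v := one_le_pow₀ (by rw [hB]; push_cast; omega)
      -- The divergence gives `w e ≤ numElts * B ^ pos v + K`, and `1 ≤ B ^ pos v` lets `K` be
      -- absorbed into the factor `B = numElts + K + 1`.
      have h5 : (D.w e : ℤ) ≤ (B : ℤ) ^ (D.pos v + 1) := by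
        rw [pow_succ, hB]
        push_cast
        rw [hB] at h2 h4
        push_cast at h2 h4
        nlinarith
      have h6 : (B : ℤ) ^ (D.pos v + 1) ≤ (B : ℤ) ^ k :=
        pow_le_pow_right₀ (by rw [hB]; push_cast; omega) hv
      exact_mod_cast h5.trans h6

end MarkedFloorDiagram

/-- All diagrams have the same number of elements and the same lists of values of `L` and `R`, and
their weights are uniformly bounded by `w_le`. Codes are therefore words of fixed length in a finite
alphabet. -/
theorem codes_finite (Δ : Set (ℝ × ℝ)) (g : ℕ) : (codes Δ g).Finite := by
  by_cases hne : Nonempty (MarkedFloorDiagram Δ g)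
  swap
  · rw [not_nonempty_iff] at hne
    rw [codes, Set.range_eq_empty]
    exact Set.finite_empty
  obtain ⟨D₀⟩ := hne
  set n := D₀.numElts with hn
  set PL := Finset.univ.image D₀.L with hPL
  set PR := Finset.univ.image D₀.R with hPR
  have hLmem : ∀ (D : MarkedFloorDiagram Δ g) (v : D.V), D.L v ∈ PL := by
    intro D v
    have h1 := D.L_bij (D.L v)
    have h2 := D₀.L_bij (D.L v)
    have h3 : 0 < (Finset.univ.filter fun v' => D.L v' = D.L v).card :=
      Finset.card_pos.2 ⟨v, by simp⟩
    rw [h1, ← h2] at h3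
    obtain ⟨v', hv'⟩ := Finset.card_pos.1 h3
    exact Finset.mem_image.2 ⟨v', Finset.mem_univ _, by simpa using hv'⟩
  have hRmem : ∀ (D : MarkedFloorDiagram Δ g) (v : D.V), D.R v ∈ PR := by
    intro D v
    have h1 := D.R_bij (D.R v)
    have h2 := D₀.R_bij (D.R v)
    have h3 : 0 < (Finset.univ.filter fun v' => D.R v' = D.R v).card :=
      Finset.card_pos.2 ⟨v, by simp⟩
    rw [h1, ← h2] at h3
    obtain ⟨v', hv'⟩ := Finset.card_pos.1 h3
    exact Finset.mem_image.2 ⟨v', Finset.mem_univ _, by simpa using hv'⟩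
  set K : ℕ := ∑ l ∈ PL, l.natAbs + ∑ r ∈ PR, r.natAbs with hKdef
  have hK : ∀ (D : MarkedFloorDiagram Δ g) (v : D.V), -(K : ℤ) ≤ D.L v + D.R v := by
    intro D v
    have h1 : (D.L v).natAbs ≤ ∑ l ∈ PL, l.natAbs :=
      Finset.single_le_sum (f := Int.natAbs) (fun _ _ => Nat.zero_le _) (hLmem D v)
    have h2 : (D.R v).natAbs ≤ ∑ l ∈ PR, l.natAbs :=
      Finset.single_le_sum (f := Int.natAbs) (fun _ _ => Nat.zero_le _) (hRmem D v)
    omega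
  set O : Set (Option ℕ) := insert none (some '' Set.Icc 1 n) with hO
  have hOfin : O.Finite := ((Set.finite_Icc 1 n).image _).insert _
  set A : Set Label := {Label.out} ∪ (fun p : ℤ × ℤ => Label.vertex p.1 p.2) '' (PL ×ˢ PR : Set _) ∪
    (fun p : Option ℕ × Option ℕ × ℕ => Label.edge p.1 p.2.1 p.2.2) ''
      (O ×ˢ O ×ˢ Set.Iic ((n + K + 1) ^ n)) with hA
  have hAfin : A.Finite := by
    refine ((Set.finite_singleton _).union (Set.Finite.image _ ?_)).union (Set.Finite.image _ ?_)
    · exact PL.finite_toSet.prod PR.finite_toSet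
    · exact hOfin.prod (hOfin.prod (Set.finite_Iic _))
  have hout : ∀ D : MarkedFloorDiagram Δ g, D.numElts = n := fun D =>
    D.numElts_eq D₀.toFloorDiagram
  have hOmem : ∀ (D : MarkedFloorDiagram Δ g) (o : Option D.V), o.map D.pos ∈ O := by
    rintro D (_ | v)
    · exact Set.mem_insert _ _
    · exact Set.mem_insert_of_mem _ ⟨D.pos v, hout D ▸ D.m_mem _, rfl⟩
  have hmem : ∀ (D : MarkedFloorDiagram Δ g) (k : ℕ), D.code k ∈ A := by
    intro D k
    by_cases hk : k ∈ Set.Icc 1 D.numElts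
    · obtain ⟨v | e, rfl⟩ := D.exists_m_eq hk
      · rw [D.code_m]
        exact Or.inl (Or.inr ⟨(_, _), ⟨hLmem D v, hRmem D v⟩, rfl⟩)
      · rw [D.code_m]
        refine Or.inr ⟨(_, _, _), ⟨hOmem D _, hOmem D _, ?_⟩, rfl⟩
        refine (D.w_le K (hK D) e).trans ?_
        rw [hout D]
        exact Nat.pow_le_pow_right (by omega) (hout D ▸ hk.2)
    · rw [(D.code_eq_out_iff k).2 hk]
      exact Or.inl (Or.inl rfl)
  -- Beyond `n` every code is `out`, so restricting to `0, …, n` loses nothing.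
  have hfin : (Set.pi Set.univ fun _ : Fin (n + 1) => A).Finite := Set.Finite.pi fun _ => hAfin
  refine Set.Finite.of_finite_image (f := fun (c : Code) (k : Fin (n + 1)) => c k)
    (hfin.subset ?_) ?_
  · rintro _ ⟨_, ⟨D, rfl⟩, rfl⟩ k -
    exact hmem D k
  · rintro _ ⟨D, rfl⟩ _ ⟨D', rfl⟩ h
    funext k
    by_cases hk : k < n + 1
    · exact congrFun h ⟨k, hk⟩
    · rw [(D.code_eq_out_iff k).2 (by rw [hout]; simp; omega),
        (D'.code_eq_out_iff k).2 (by rw [hout]; simp; omega)]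

theorem markedClass_finite (Δ : Set (ℝ × ℝ)) (g : ℕ) : Finite (MarkedClass Δ g) := by
  have := (codes_finite Δ g).to_subtype
  rw [← MarkedClass.range_code] at this
  exact Finite.of_injective_finite_range MarkedClass.code_injective

/-! ### Boundary points of a lattice polygon -/

theorem convexHull_snd_le {A : Set (ℝ × ℝ)} {M : ℝ} (h : ∀ p ∈ A, p.2 ≤ M) :
    ∀ p ∈ convexHull ℝ A, p.2 ≤ M := by
  intro p hp
  have hc : Convex ℝ {p : ℝ × ℝ | p.2 ≤ M} :=
    convex_halfSpace_le (LinearMap.isLinear (LinearMap.snd ℝ ℝ ℝ)) M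
  exact convexHull_min (fun q hq => h q hq) hc hp

theorem le_convexHull_snd {A : Set (ℝ × ℝ)} {M : ℝ} (h : ∀ p ∈ A, M ≤ p.2) :
    ∀ p ∈ convexHull ℝ A, M ≤ p.2 := by
  intro p hp
  have hc : Convex ℝ {p : ℝ × ℝ | M ≤ p.2} :=
    convex_halfSpace_ge (LinearMap.isLinear (LinearMap.snd ℝ ℝ ℝ)) M
  exact convexHull_min (fun q hq => h q hq) hc hp

theorem IsLatticePolygon.exists_snd_bounds {Δ : Set (ℝ × ℝ)} (h : IsLatticePolygon Δ) :
    ∃ b t : ℤ, (∀ p ∈ Δ, (b : ℝ) ≤ p.2 ∧ p.2 ≤ t) ∧ height Δ = t - b := by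
  obtain ⟨⟨A, hA, rfl⟩, hint⟩ := h
  have hAne : A.Nonempty := by
    have := hint.mono interior_subset
    rwa [convexHull_nonempty_iff, Finset.coe_nonempty] at this
  obtain ⟨p, hp, hpmax⟩ := A.exists_max_image Prod.snd hAne
  obtain ⟨q, hq, hqmin⟩ := A.exists_min_image Prod.snd hAne
  obtain ⟨p', rfl⟩ := hA hp
  obtain ⟨q', rfl⟩ := hA hq
  have h1 := convexHull_snd_le (A := A) hpmax
  have h2 := le_convexHull_snd (A := A) hqmin
  refine ⟨q'.2, p'.2, fun x hx => ⟨h2 x hx, h1 x hx⟩, ?_⟩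
  have hs : IsGreatest (Prod.snd '' convexHull ℝ (A : Set (ℝ × ℝ))) (p'.2 : ℝ) :=
    ⟨⟨_, subset_convexHull ℝ _ hp, rfl⟩, by rintro _ ⟨x, hx, rfl⟩; exact h1 x hx⟩
  have hi : IsLeast (Prod.snd '' convexHull ℝ (A : Set (ℝ × ℝ))) (q'.2 : ℝ) :=
    ⟨⟨_, subset_convexHull ℝ _ hq, rfl⟩, by rintro _ ⟨x, hx, rfl⟩; exact h2 x hx⟩
  rw [height, hs.csSup_eq, hi.csInf_eq]

theorem IsLatticePolygon.isCompact {Δ : Set (ℝ × ℝ)} (h : IsLatticePolygon Δ) : IsCompact Δ := by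
  obtain ⟨⟨A, -, rfl⟩, -⟩ := h
  exact A.finite_toSet.isCompact_convexHull ℝ

theorem IsLatticePolygon.convex {Δ : Set (ℝ × ℝ)} (h : IsLatticePolygon Δ) : Convex ℝ Δ := by
  obtain ⟨⟨A, -, rfl⟩, -⟩ := h
  exact convex_convexHull ℝ _

theorem IsLatticePolygon.finite_inter_lattice {Δ : Set (ℝ × ℝ)} (h : IsLatticePolygon Δ) :
    (Δ ∩ lattice).Finite := by
  obtain ⟨r, hr⟩ := h.isCompact.isBounded.subset_closedBall (0 : ℝ × ℝ)
  refine (((Set.finite_Icc (-⌈r⌉) ⌈r⌉).prod (Set.finite_Icc (-⌈r⌉) ⌈r⌉)).image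
    fun p : ℤ × ℤ => ((p.1 : ℝ), (p.2 : ℝ))).subset ?_
  rintro _ ⟨hp, p, rfl⟩
  have hp' := hr hp
  rw [mem_closedBall_zero_iff, Prod.norm_def, max_le_iff] at hp'
  simp only [Real.norm_eq_abs, abs_le] at hp'
  obtain ⟨⟨h1, h2⟩, h3, h4⟩ := hp'
  have hc := Int.le_ceil r
  refine ⟨p, ⟨⟨?_, ?_⟩, ?_, ?_⟩, rfl⟩
  all_goals
    rify
    linarith

/-- A boundary point strictly between two points at the same height is at extremal height. -/
theorem IsLatticePolygon.mem_face_of_between {Δ : Set (ℝ × ℝ)} (h : IsLatticePolygon Δ)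
    {p p' p'' : ℝ × ℝ} (hp : p ∈ frontier Δ) (hp' : p' ∈ Δ) (hp'' : p'' ∈ Δ)
    (h1 : p'.2 = p.2) (h2 : p''.2 = p.2) (h3 : p'.1 < p.1) (h4 : p.1 < p''.1) :
    p ∈ face Δ (0, 1) ∨ p ∈ face Δ (0, -1) := by
  have hcl : IsClosed Δ := h.isCompact.isClosed
  have hpΔ : p ∈ Δ := hcl.frontier_subset hp
  have hpi : p ∉ interior Δ := by
    rw [hcl.frontier_eq] at hp
    exact hp.2
  -- `f` defines a supporting line at `p`. Its maximality against points on both sides of `p` at the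
  -- same height forces this line to be horizontal; strictness on the interior then rules out `f =
  -- 0`.
  obtain ⟨f, hf⟩ := geometric_hahn_banach_open_point h.convex.interior isOpen_interior hpi
  have hle : ∀ x ∈ Δ, f x ≤ f p := by
    have hsub : closure (interior Δ) ⊆ {x | f x ≤ f p} :=
      closure_minimal (fun x hx => (hf x hx).le) (isClosed_le f.continuous continuous_const)
    rw [h.convex.closure_interior_eq_closure_of_nonempty_interior h.2, hcl.closure_eq] at hsub
    exact hsub
  have hfx : ∀ x : ℝ × ℝ, f x = x.1 * f (1, 0) + x.2 * f (0, 1) := by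
    intro x
    have : x = x.1 • ((1 : ℝ), (0 : ℝ)) + x.2 • ((0 : ℝ), (1 : ℝ)) := by ext <;> simp
    conv_lhs => rw [this]
    rw [map_add, map_smul, map_smul, smul_eq_mul, smul_eq_mul]
  have e1 := hle p' hp'
  have e2 := hle p'' hp''
  rw [hfx p', hfx p, h1] at e1
  rw [hfx p'', hfx p, h2] at e2
  have hz : f (1, 0) = 0 := by nlinarith
  obtain ⟨x₀, hx₀⟩ := h.2
  have e3 := hf x₀ hx₀
  rw [hfx x₀, hfx p, hz] at e3
  rcases lt_trichotomy (f (0, 1)) 0 with hneg | hzero | hpos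
  · right
    refine ⟨hpΔ, fun x hx => ?_⟩
    have := hle x hx
    rw [hfx x, hfx p, hz] at this
    simp only [zero_mul, zero_add, neg_mul, one_mul]
    nlinarith
  · rw [hzero] at e3
    simp at e3
  · left
    refine ⟨hpΔ, fun x hx => ?_⟩
    have := hle x hx
    rw [hfx x, hfx p, hz] at this
    simp only [zero_mul, zero_add, one_mul]
    nlinarith

/-- A set of points on a horizontal line, none of which is strictly between two others, has at most
two elements. -/
theorem ncard_le_two_of_no_between {X : Set (ℝ × ℝ)} {y : ℝ} (hy : ∀ p ∈ X, p.2 = y)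
    (h : ∀ p ∈ X, ∀ p' ∈ X, ∀ p'' ∈ X, p'.1 < p.1 → p.1 < p''.1 → False) : X.ncard ≤ 2 := by
  by_contra hc
  rw [not_le] at hc
  have hfin : X.Finite := Set.finite_of_ncard_pos (by omega)
  obtain ⟨a, b, c, ha, hb, hc', hab, hac, hbc⟩ := (Set.two_lt_ncard_iff hfin).1 hc
  have hne : ∀ p ∈ X, ∀ q ∈ X, p ≠ q → p.1 ≠ q.1 := fun p hp q hq hpq h' =>
    hpq (Prod.ext h' ((hy p hp).trans (hy q hq).symm))
  have h1 := hne a ha b hb hab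
  have h2 := hne a ha c hc' hac
  have h3 := hne b hb c hc' hbc
  rcases lt_or_gt_of_ne h1 with h1 | h1 <;> rcases lt_or_gt_of_ne h2 with h2 | h2 <;>
    rcases lt_or_gt_of_ne h3 with h3 | h3
  · exact h b hb a ha c hc' h1 h3
  · exact h c hc' a ha b hb h2 h3
  · linarith
  · exact h a ha c hc' b hb h2 h1
  · exact h a ha b hb c hc' h1 h2
  · linarith
  · exact h c hc' b hb a ha h3 h2
  · exact h b hb c hc' a ha h3 h1

theorem ncard_le_latticeLength (F : Set (ℝ × ℝ)) : (F ∩ lattice).ncard ≤ latticeLength F + 1 := by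
  unfold latticeLength
  omega

/-- Each of the `a - 1` intermediate integral heights carries at most two boundary lattice points,
and the top and bottom faces carry one more point than their lengths. -/
theorem IsLatticePolygon.boundaryPoints_le {Δ : Set (ℝ × ℝ)} (h : IsLatticePolygon Δ) {a : ℕ}
    (ha : 0 < a) (hh : (a : ℝ) = height Δ) :
    boundaryPoints Δ ≤ 2 * a + topLength Δ + bottomLength Δ := by
  obtain ⟨b, t, hbt, hheight⟩ := h.exists_snd_bounds
  have hcl : IsClosed Δ := h.isCompact.isClosed
  have hat : t = b + a := by
    rw [hheight] at hh
    have : (a : ℤ) = t - b := by exact_mod_cast hh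
    omega
  set Y : ℤ → Set (ℝ × ℝ) := fun j =>
    {p | p ∈ frontier Δ ∩ lattice ∧ p.2 = j ∧ p ∉ face Δ (0, 1) ∧ p ∉ face Δ (0, -1)} with hY
  have hY2 : ∀ j, (Y j).ncard ≤ 2 := by
    intro j
    refine ncard_le_two_of_no_between (y := j) (fun p hp => hp.2.1) ?_
    intro p hp p' hp' p'' hp'' h1 h2
    rcases h.mem_face_of_between hp.1.1 (hcl.frontier_subset hp'.1.1)
      (hcl.frontier_subset hp''.1.1) (hp'.2.1.trans hp.2.1.symm) (hp''.2.1.trans hp.2.1.symm)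
      h1 h2 with h3 | h3
    · exact hp.2.2.1 h3
    · exact hp.2.2.2 h3
  have hcover : frontier Δ ∩ lattice ⊆ (face Δ (0, 1) ∩ lattice ∪ face Δ (0, -1) ∩ lattice) ∪
      ⋃ j ∈ Finset.Ioo b t, Y j := by
    rintro p ⟨hp, hpl⟩
    by_cases h1 : p ∈ face Δ (0, 1)
    · exact Or.inl (Or.inl ⟨h1, hpl⟩)
    by_cases h2 : p ∈ face Δ (0, -1)
    · exact Or.inl (Or.inr ⟨h2, hpl⟩)
    refine Or.inr ?_
    obtain ⟨x, rfl⟩ := hpl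
    have hpΔ := hcl.frontier_subset hp
    obtain ⟨h3, h4⟩ := hbt _ hpΔ
    simp only [Int.cast_le] at h3 h4
    simp only [Set.mem_iUnion]
    refine ⟨x.2, ?_, ⟨hp, x, rfl⟩, rfl, h1, h2⟩
    rw [Finset.mem_Ioo]
    refine ⟨lt_of_le_of_ne h3 ?_, lt_of_le_of_ne h4 ?_⟩
    · rintro rfl
      refine h2 ⟨hpΔ, fun q hq => ?_⟩
      have := (hbt q hq).1
      simp only [zero_mul, zero_add, neg_mul, one_mul]
      linarith
    · rintro rfl
      refine h1 ⟨hpΔ, fun q hq => ?_⟩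
      have := (hbt q hq).2
      simp only [zero_mul, zero_add, one_mul]
      linarith
  have hfin : ((face Δ (0, 1) ∩ lattice ∪ face Δ (0, -1) ∩ lattice) ∪
      ⋃ j ∈ Finset.Ioo b t, Y j).Finite := by
    refine h.finite_inter_lattice.subset ?_
    rintro p ((hp | hp) | hp)
    · exact ⟨hp.1.1, hp.2⟩
    · exact ⟨hp.1.1, hp.2⟩
    · simp only [Set.mem_iUnion] at hp
      obtain ⟨j, -, hp⟩ := hp
      exact ⟨hcl.frontier_subset hp.1.1, hp.1.2⟩
  have hU : (⋃ j ∈ Finset.Ioo b t, Y j).ncard ≤ 2 * (a - 1) := by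
    refine (Finset.set_ncard_biUnion_le _ _).trans ?_
    refine (Finset.sum_le_card_nsmul _ _ 2 fun j _ => hY2 j).trans ?_
    rw [Int.card_Ioo, smul_eq_mul]
    omega
  have h1 := Set.ncard_le_ncard hcover hfin
  have h2 := Set.ncard_union_le (face Δ (0, 1) ∩ lattice ∪ face Δ (0, -1) ∩ lattice)
    (⋃ j ∈ Finset.Ioo b t, Y j)
  have h3 := Set.ncard_union_le (face Δ (0, 1) ∩ lattice) (face Δ (0, -1) ∩ lattice)
  have h4 := ncard_le_latticeLength (face Δ (0, 1))
  have h5 := ncard_le_latticeLength (face Δ (0, -1))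
  unfold boundaryPoints topLength bottomLength
  omega

/-- This inequality is all that is needed: a pairing of `{1, …, y - 1 + g}` is then also a pairing
of the positions of every marking. -/
theorem FloorDiagram.boundaryPoints_le_numElts {Δ : Set (ℝ × ℝ)} {g : ℕ} (h : IsLatticePolygon Δ)
    (D : FloorDiagram Δ g) : boundaryPoints Δ - 1 + g ≤ D.numElts := by
  have h1 := h.boundaryPoints_le D.card_pos D.card_vertices
  have h2 := D.numElts_add_one
  have h3 := D.card_pos
  omega

/-! ### Multiplicities of codes -/

/-- The factor of an unpaired element. -/
def Label.single : Label → RatFunc ℚ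
  | .edge _ _ w => quantum w ^ 2
  | _ => 1

/-- The factor of an element paired with an adjacent one. -/
def Label.paired : Label → RatFunc ℚ
  | .edge _ _ w => quantum₂ w
  | _ => 1

/-- The factor of two edges of weights `a` and `b` that are paired together. -/
def edgePair (a b : ℕ) : RatFunc ℚ := quantum a * quantum b * quantum ((a : ℤ) + b) / quantum 2

/-- The factor of two elements that are paired without being adjacent. -/
def Label.share : Label → Label → RatFunc ℚ
  | .edge s t w, .edge s' t' w' =>
    -- Two sources both have origin `none`, and two sinks both have end `none`, without sharing a
    -- vertex there.
    if s = s' ∧ s ≠ none ∨ t = t' ∧ t ≠ none then edgePair w w' else 0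
  | _, _ => 0

/-- The element at `j` and the one at `k` are an edge and its target, or a vertex and an edge
leaving it. -/
def Code.Step (c : Code) (j k : ℕ) : Prop :=
  (∃ s w, c j = .edge s (some k) w) ∨ ∃ t w, c k = .edge (some j) t w

/-- The factor of the pair of the elements at `j` and `k`. -/
def Code.pairFactor (c : Code) (j k : ℕ) : RatFunc ℚ :=
  if c.Step j k ∨ c.Step k j then (c j).paired * (c k).paired else (c j).share (c k)

/-- The positions covered by the pairs `{i, i + 1}`, `i ∈ I`. -/
def cover (I : Finset ℕ) : Finset ℕ := I ∪ I.image (· + 1)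

/-- The set of the pairs `{i, i + 1}`, `i ∈ I`. -/
def pairs (I : Finset ℕ) : Finset (Finset ℕ) := I.image fun i => {i, i + 1}

/-- The multiplicity of a code with respect to the pairs `{i, i + 1}`, `i ∈ I`. -/
def Code.mult (n : ℕ) (I : Finset ℕ) (c : Code) : RatFunc ℚ :=
  (∏ k ∈ Finset.Icc 1 n \ cover I, (c k).single) * ∏ i ∈ I, c.pairFactor i (i + 1)

theorem edgePair_comm (a b : ℕ) : edgePair a b = edgePair b a := by
  unfold edgePair
  rw [mul_comm (quantum a), add_comm (a : ℤ)]

theorem Label.share_comm (x y : Label) : x.share y = y.share x := by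
  cases x <;> cases y <;> try rfl
  rename_i s t w s' t' w'
  simp only [Label.share, edgePair_comm w w']
  congr 1
  apply propext
  constructor <;> (rintro (⟨rfl, h⟩ | ⟨rfl, h⟩) <;> simp [h])

theorem Code.pairFactor_comm (c : Code) (j k : ℕ) : c.pairFactor j k = c.pairFactor k j := by
  unfold Code.pairFactor
  simp only [or_comm (a := c.Step j k), mul_comm (c j).paired, Label.share_comm (c j)]

/-! ### Comparison of the multiplicities of diagrams and of codes -/

namespace MarkedFloorDiagram

variable {Δ : Set (ℝ × ℝ)} {g : ℕ} (D : MarkedFloorDiagram Δ g)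

theorem step_inr_inl (e : D.E) (v : D.V) :
    D.code.Step (D.m (Sum.inr e)) (D.pos v) ↔ D.tgt e = some v := by
  simp [Code.Step, code_inr, code_pos, D.pos_injective.eq_iff]

theorem step_inl_inr (e : D.E) (v : D.V) :
    D.code.Step (D.pos v) (D.m (Sum.inr e)) ↔ D.src e = some v := by
  simp [Code.Step, code_inr, code_pos, D.pos_injective.eq_iff]

theorem not_step_inl_inl (v v' : D.V) : ¬ D.code.Step (D.pos v) (D.pos v') := by
  simp [Code.Step, code_pos]

theorem pos_ne_m_inr (v : D.V) (e : D.E) : D.pos v ≠ D.m (Sum.inr e) :=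
  D.m_injective.ne (by simp)

theorem not_step_inr_inr (e e' : D.E) : ¬ D.code.Step (D.m (Sum.inr e)) (D.m (Sum.inr e')) := by
  simp [Code.Step, code_inr, pos_ne_m_inr]

theorem pairFactor_inl_inl (v v' : D.V) : D.code.pairFactor (D.pos v) (D.pos v') = 0 := by
  simp [Code.pairFactor, not_step_inl_inl, code_pos, Label.share]

theorem pairFactor_inr_inl (e : D.E) (v : D.V) :
    D.code.pairFactor (D.m (Sum.inr e)) (D.pos v) =
      if D.src e = some v ∨ D.tgt e = some v then quantum₂ (D.w e) else 0 := by
  simp only [Code.pairFactor, step_inr_inl, step_inl_inr, or_comm (a := D.tgt e = some v), code_inr,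
    code_pos, Label.paired, Label.share, mul_one]

theorem pairFactor_inr_inr (e e' : D.E) :
    D.code.pairFactor (D.m (Sum.inr e)) (D.m (Sum.inr e')) =
      if ∃ v, (D.tgt e = some v ∧ D.tgt e' = some v) ∨ (D.src e = some v ∧ D.src e' = some v) then
        edgePair (D.w e) (D.w e') else 0 := by
  rw [Code.pairFactor, if_neg (by simp [not_step_inr_inr]), code_inr, code_inr, Label.share]
  congr 1
  apply propext
  rw [(Option.map_injective D.pos_injective).eq_iff, (Option.map_injective D.pos_injective).eq_iff]
  constructor
  · rintro (⟨h, h'⟩ | ⟨h, h'⟩)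
    · obtain ⟨v, hv⟩ := Option.ne_none_iff_exists'.1 (show D.src e ≠ none by simpa using h')
      exact ⟨v, Or.inr ⟨hv, h ▸ hv⟩⟩
    · obtain ⟨v, hv⟩ := Option.ne_none_iff_exists'.1 (show D.tgt e ≠ none by simpa using h')
      exact ⟨v, Or.inl ⟨hv, h ▸ hv⟩⟩
  · rintro ⟨v, (⟨h, h'⟩ | ⟨h, h'⟩)⟩
    · exact Or.inr ⟨h.trans h'.symm, by simp [h]⟩
    · exact Or.inl ⟨h.trans h'.symm, by simp [h]⟩

/-- The elements at `i` and `i + 1` are an edge and an adjacent vertex. -/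
def VertexPair (i : ℕ) (e : D.E) (v : D.V) : Prop :=
  D.fiber {i, i + 1} = {Sum.inr e, Sum.inl v} ∧ (D.src e = some v ∨ D.tgt e = some v)

/-- The elements at `i` and `i + 1` are two edges entering or leaving the same vertex. -/
def EdgePair (i : ℕ) (e e' : D.E) : Prop :=
  ∃ v : D.V, e ≠ e' ∧ D.fiber {i, i + 1} = {Sum.inr e, Sum.inr e'} ∧
    ((D.tgt e = some v ∧ D.tgt e' = some v) ∨ (D.src e = some v ∧ D.src e' = some v))

theorem fiber_pair {i : ℕ} {x y : D.V ⊕ D.E} (hx : D.m x = i) (hy : D.m y = i + 1) :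
    D.fiber {i, i + 1} = {x, y} := by
  ext z
  change D.m z ∈ ({i, i + 1} : Finset ℕ) ↔ _
  rw [Finset.mem_insert, Finset.mem_singleton, ← hy, ← hx, D.m_injective.eq_iff,
    D.m_injective.eq_iff]
  rfl

theorem m_of_fiber {i : ℕ} {x y : D.V ⊕ D.E} (hxy : x ≠ y) (h : D.fiber {i, i + 1} = {x, y}) :
    (D.m x = i ∧ D.m y = i + 1) ∨ (D.m y = i ∧ D.m x = i + 1) := by
  have hx : D.m x ∈ ({i, i + 1} : Finset ℕ) := by
    have : x ∈ D.fiber {i, i + 1} := by rw [h]; simp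
    exact this
  have hy : D.m y ∈ ({i, i + 1} : Finset ℕ) := by
    have : y ∈ D.fiber {i, i + 1} := by rw [h]; simp
    exact this
  have hne := D.m_injective.ne hxy
  simp only [Finset.mem_insert, Finset.mem_singleton] at hx hy
  omega

theorem VertexPair.pairFactor {D : MarkedFloorDiagram Δ g} {i : ℕ} {e : D.E} {v : D.V}
    (h : D.VertexPair i e v) : D.code.pairFactor i (i + 1) = quantum₂ (D.w e) := by
  have key : D.code.pairFactor (D.m (Sum.inr e)) (D.m (Sum.inl v)) = quantum₂ (D.w e) :=
    (D.pairFactor_inr_inl e v).trans (if_pos h.2)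
  rcases D.m_of_fiber (by simp) h.1 with ⟨h1, h2⟩ | ⟨h1, h2⟩
  · rw [← key, h1, h2]
  · rw [← key, h1, h2, Code.pairFactor_comm]

theorem EdgePair.pairFactor {D : MarkedFloorDiagram Δ g} {i : ℕ} {e e' : D.E}
    (h : D.EdgePair i e e') : D.code.pairFactor i (i + 1) = edgePair (D.w e) (D.w e') := by
  obtain ⟨v, hne, hf, hv⟩ := h
  have key : D.code.pairFactor (D.m (Sum.inr e)) (D.m (Sum.inr e')) = edgePair (D.w e) (D.w e') :=
    (D.pairFactor_inr_inr e e').trans (if_pos ⟨v, hv⟩)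
  rcases D.m_of_fiber (by simpa using hne) hf with ⟨h1, h2⟩ | ⟨h1, h2⟩
  · rw [← key, h1, h2]
  · rw [← key, h1, h2, Code.pairFactor_comm]

/-- This builds the compatibility condition into the product of local factors: one bad pair kills
it. -/
theorem pairFactor_eq_zero {i : ℕ} (h1 : 1 ≤ i) (h2 : i + 1 ≤ D.numElts)
    (h : ¬ ((∃ e v, D.VertexPair i e v) ∨ ∃ e e', D.EdgePair i e e')) :
    D.code.pairFactor i (i + 1) = 0 := by
  obtain ⟨x, hx⟩ := D.exists_m_eq (k := i) ⟨h1, by omega⟩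
  obtain ⟨y, hy⟩ := D.exists_m_eq (k := i + 1) ⟨by omega, h2⟩
  have hf := D.fiber_pair hx hy
  rw [not_or] at h
  rcases x with v | e <;> rcases y with v' | e' <;> rw [← hy, ← hx]
  · exact D.pairFactor_inl_inl v v'
  · rw [Code.pairFactor_comm]
    refine (D.pairFactor_inr_inl e' v).trans (if_neg fun hc => h.1 ⟨e', v, ?_, hc⟩)
    rw [hf, Set.pair_comm]
  · exact (D.pairFactor_inr_inl e v').trans (if_neg fun hc => h.1 ⟨e, v', hf, hc⟩)
  · refine (D.pairFactor_inr_inr e e').trans (if_neg ?_)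
    rintro ⟨v, hv⟩
    refine h.2 ⟨e, e', v, ?_, hf, hv⟩
    rintro rfl
    omega

theorem prod_E₀ (I : Finset ℕ) :
    ∏ e ∈ D.E₀ (pairs I), quantum (D.w e) ^ 2 =
      ∏ k ∈ Finset.Icc 1 D.numElts \ cover I, (D.code k).single := by
  have hmem : ∀ e, e ∈ D.E₀ (pairs I) ↔ D.m (Sum.inr e) ∉ cover I := by
    intro e
    have : ∀ i, Sum.inr e ∈ D.fiber {i, i + 1} ↔ D.m (Sum.inr e) = i ∨ D.m (Sum.inr e) = i + 1 := by
      intro i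
      change D.m _ ∈ ({i, i + 1} : Finset ℕ) ↔ _
      simp
    simp only [E₀, pairs, cover, Finset.mem_filter, Finset.mem_univ, true_and, Finset.mem_image,
      forall_exists_index, and_imp, forall_apply_eq_imp_iff₂, this, Finset.mem_union, not_or,
      not_exists, not_and]
    constructor
    · exact fun h => ⟨fun h' => (h _ h').1 rfl, fun i hi h' => (h i hi).2 h'.symm⟩
    · exact fun h i hi => ⟨fun h' => h.1 (h' ▸ hi), fun h' => h.2 i hi h'.symm⟩
  rw [← Finset.prod_subset (s₁ := (D.E₀ (pairs I)).image fun e => D.m (Sum.inr e))]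
  · rw [Finset.prod_image]
    · refine Finset.prod_congr rfl fun e _ => ?_
      rw [code_inr]
      rfl
    · exact fun e _ e' _ h => Sum.inr_injective (D.m_injective h)
  · intro k hk
    obtain ⟨e, he, rfl⟩ := Finset.mem_image.1 hk
    rw [Finset.mem_sdiff, Finset.mem_Icc]
    exact ⟨D.m_mem _, (hmem e).1 he⟩
  · intro k hk hk'
    rw [Finset.mem_sdiff, Finset.mem_Icc] at hk
    obtain ⟨v | e, rfl⟩ := D.exists_m_eq hk.1
    · rw [code_m]
      rfl
    · exact absurd (Finset.mem_image.2 ⟨e, (hmem e).2 hk.2, rfl⟩) hk'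

/-- The pairs are disjoint. This gives the injectivity needed to turn products over edges, or over
pairs of edges, into products over `I`. -/
theorem index_unique {I : Finset ℕ} (hI : ∀ i ∈ I, i + 1 ∉ I) {i j : ℕ} (hi : i ∈ I) (hj : j ∈ I)
    {x : D.V ⊕ D.E} (h1 : x ∈ D.fiber {i, i + 1}) (h2 : x ∈ D.fiber {j, j + 1}) : i = j := by
  change D.m x ∈ ({i, i + 1} : Finset ℕ) at h1
  change D.m x ∈ ({j, j + 1} : Finset ℕ) at h2
  simp only [Finset.mem_insert, Finset.mem_singleton] at h1 h2
  rcases h1 with h1 | h1 <;> rcases h2 with h2 | h2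
  · omega
  · exact absurd (show j + 1 ∈ I by rwa [← h2, h1]) (hI j hj)
  · exact absurd (show i + 1 ∈ I by rwa [← h1, h2]) (hI i hi)
  · omega

theorem prod_E₁ {I : Finset ℕ} (hI : ∀ i ∈ I, i + 1 ∉ I)
    (h : ∀ i ∈ I, (∃ e v, D.VertexPair i e v) ∨ ∃ e e', D.EdgePair i e e') :
    ∏ e ∈ D.E₁ (pairs I), quantum₂ (D.w e) =
      ∏ i ∈ I.filter fun i => ∃ e v, D.VertexPair i e v, D.code.pairFactor i (i + 1) := by
  symm
  have h' : ∀ i ∈ I.filter fun i => ∃ e v, D.VertexPair i e v, ∃ e v, D.VertexPair i e v :=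
    fun i hi => (Finset.mem_filter.1 hi).2
  choose e v hev using h'
  refine Finset.prod_bij e ?_ ?_ ?_ ?_
  · intro i hi
    simp only [E₁, Finset.mem_filter, Finset.mem_univ, true_and]
    exact ⟨v i hi, _, Finset.mem_image_of_mem _ (Finset.mem_filter.1 hi).1, (hev i hi).1.symm⟩
  · intro i hi j hj hij
    refine D.index_unique hI (Finset.mem_filter.1 hi).1 (Finset.mem_filter.1 hj).1
      (x := Sum.inr (e i hi)) ?_ ?_
    · rw [(hev i hi).1]; simp
    · rw [(hev j hj).1, hij]; simp
  · intro e' he'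
    simp only [E₁, Finset.mem_filter, Finset.mem_univ, true_and] at he'
    obtain ⟨v', α, hα, hf⟩ := he'
    obtain ⟨i, hi, rfl⟩ := Finset.mem_image.1 hα
    have hi' : i ∈ I.filter fun i => ∃ e v, D.VertexPair i e v := by
      refine Finset.mem_filter.2 ⟨hi, (h i hi).resolve_right ?_⟩
      rintro ⟨e₁, e₂, u, -, hf', -⟩
      have : Sum.inl v' ∈ D.fiber {i, i + 1} := by rw [← hf]; simp
      rw [hf'] at this
      simp at this
    refine ⟨i, hi', ?_⟩
    have : Sum.inr e' ∈ D.fiber {i, i + 1} := by rw [← hf]; simp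
    rw [(hev i hi').1] at this
    simpa [eq_comm] using this
  · intro i hi
    exact (hev i hi).pairFactor

theorem prod_E₂ {I : Finset ℕ} (hI : ∀ i ∈ I, i + 1 ∉ I)
    (h : ∀ i ∈ I, (∃ e v, D.VertexPair i e v) ∨ ∃ e e', D.EdgePair i e e') :
    ∏ P ∈ D.E₂ (pairs I), (∏ e ∈ P, quantum (D.w e)) * quantum (∑ e ∈ P, (D.w e : ℤ)) / quantum 2 =
      ∏ i ∈ I.filter fun i => ¬ ∃ e v, D.VertexPair i e v, D.code.pairFactor i (i + 1) := by
  symm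
  have h' : ∀ i ∈ I.filter fun i => ¬ ∃ e v, D.VertexPair i e v, ∃ e e', D.EdgePair i e e' :=
    fun i hi => (h i (Finset.mem_filter.1 hi).1).resolve_left (Finset.mem_filter.1 hi).2
  choose e e' hev using h'
  have hne : ∀ i hi, e i hi ≠ e' i hi := fun i hi => by
    obtain ⟨_, hne, _⟩ := hev i hi
    exact hne
  have hfib : ∀ i hi, D.fiber {i, i + 1} = {Sum.inr (e i hi), Sum.inr (e' i hi)} := fun i hi => by
    obtain ⟨_, _, hf, _⟩ := hev i hi
    exact hf
  have himg : ∀ i hi, D.fiber {i, i + 1} =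
      Sum.inr '' (({e i hi, e' i hi} : Finset D.E) : Set D.E) := fun i hi => by
    rw [hfib i hi, Finset.coe_pair, Set.image_pair]
  refine Finset.prod_bij (fun i hi => {e i hi, e' i hi}) ?_ ?_ ?_ ?_
  · intro i hi
    simp only [E₂, Finset.mem_filter, Finset.mem_univ, true_and]
    exact ⟨Finset.card_pair (hne i hi), _,
      Finset.mem_image_of_mem _ (Finset.mem_filter.1 hi).1, (himg i hi).symm⟩
  · intro i hi j hj hij
    refine D.index_unique hI (Finset.mem_filter.1 hi).1 (Finset.mem_filter.1 hj).1
      (x := Sum.inr (e i hi)) ?_ ?_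
    · rw [hfib i hi]; simp
    · rw [himg j hj, ← hij]; simp
  · intro P hP
    simp only [E₂, Finset.mem_filter, Finset.mem_univ, true_and] at hP
    obtain ⟨-, α, hα, hf⟩ := hP
    obtain ⟨i, hi, rfl⟩ := Finset.mem_image.1 hα
    have hi' : i ∈ I.filter fun i => ¬ ∃ e v, D.VertexPair i e v := by
      refine Finset.mem_filter.2 ⟨hi, ?_⟩
      rintro ⟨e₁, u, hf', -⟩
      have : Sum.inl u ∈ D.fiber {i, i + 1} := by rw [hf']; simp
      rw [← hf] at this
      simp at this
    refine ⟨i, hi', ?_⟩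
    rw [himg i hi'] at hf
    exact_mod_cast (Set.image_injective.2 Sum.inr_injective hf).symm
  · intro i hi
    rw [(hev i hi).pairFactor, Finset.prod_pair (hne i hi), Finset.sum_pair (hne i hi), edgePair]

/-- For a compatible marking, `I` splits into the indices of pairs with a vertex, giving the product
over `E₁`, and the others, giving the one over `E₂`. Otherwise some pair factor vanishes. -/
theorem mult_eq_code_mult {I : Finset ℕ} (hI : ∀ i ∈ I, i + 1 ∉ I)
    (hI' : ∀ i ∈ I, 1 ≤ i ∧ i + 1 ≤ D.numElts) :
    mult (pairs I) D = D.code.mult D.numElts I := by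
  have hcomp : D.Compatible (pairs I) ↔
      ∀ i ∈ I, (∃ e v, D.VertexPair i e v) ∨ ∃ e e', D.EdgePair i e e' := by
    simp only [Compatible, pairs, Finset.mem_image, forall_exists_index, and_imp,
      forall_apply_eq_imp_iff₂, VertexPair, EdgePair]
  by_cases h : D.Compatible (pairs I)
  · rw [mult, if_pos h, Code.mult, prod_E₀, mul_assoc, D.prod_E₁ hI (hcomp.1 h),
      D.prod_E₂ hI (hcomp.1 h), Finset.prod_filter_mul_prod_filter_not]
  · rw [mult, if_neg h]
    rw [hcomp] at h
    push Not at h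
    obtain ⟨i, hi, hi'⟩ := h
    rw [Code.mult, Finset.prod_eq_zero hi, mul_zero]
    refine D.pairFactor_eq_zero (hI' i hi).1 (hI' i hi).2 ?_
    rintro (⟨e, v, h'⟩ | ⟨e, e', h'⟩)
    · exact hi'.1 e v h'
    · exact hi'.2 e e' h'

end MarkedFloorDiagram

theorem G_eq_sum {Δ : Set (ℝ × ℝ)} {g n : ℕ} {I : Finset ℕ} (hI : ∀ i ∈ I, i + 1 ∉ I)
    (hI' : ∀ i ∈ I, 1 ≤ i ∧ i + 1 ≤ n) (hn : ∀ D : MarkedFloorDiagram Δ g, D.numElts = n) :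
    G g Δ (pairs I) = ∑ c ∈ (codes_finite Δ g).toFinset, Code.mult n I c := by
  rw [← finsum_mem_eq_finite_toFinset_sum, ← MarkedClass.range_code,
    finsum_mem_range MarkedClass.code_injective, G]
  refine finsum_congr fun a => Quotient.inductionOn a fun D => ?_
  change D.mult (pairs I) = D.code.mult n I
  rw [D.mult_eq_code_mult hI (by rwa [hn D]), hn D]

/-! ### Quantum integers -/

theorem qHalf_ne_zero : qHalf ≠ 0 := RatFunc.X_ne_zero

/-- With `q = qHalf ^ 2` this reads `q² ≠ 1`, so the denominators `q - 1` and `q + 1` are both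
nonzero. -/
theorem qHalf_pow_four_ne_one : qHalf ^ 4 ≠ 1 := by
  intro h
  have h1 : algebraMap (Polynomial ℚ) (RatFunc ℚ) (Polynomial.X ^ 4) = algebraMap _ _ 1 := by
    rw [map_pow, RatFunc.algebraMap_X, map_one]
    exact h
  have h2 := congrArg Polynomial.natDegree (RatFunc.algebraMap_injective ℚ h1)
  simp at h2

theorem qHalf_sq_sub_one_ne_zero : qHalf ^ 2 - 1 ≠ 0 := by
  intro h
  apply qHalf_pow_four_ne_one
  linear_combination (qHalf ^ 2 + 1) * h

theorem qHalf_sq_add_one_ne_zero : qHalf ^ 2 + 1 ≠ 0 := by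
  intro h
  apply qHalf_pow_four_ne_one
  linear_combination (qHalf ^ 2 - 1) * h

theorem quantum_natCast (a : ℕ) :
    quantum a = (qHalf ^ a - (qHalf ^ a)⁻¹) * qHalf / (qHalf ^ 2 - 1) := by
  have h0 := qHalf_ne_zero
  have h1 := qHalf_sq_sub_one_ne_zero
  have h2 : qHalf - qHalf⁻¹ = (qHalf ^ 2 - 1) / qHalf := by field_simp
  rw [quantum, quantumAt, zpow_neg, zpow_natCast, h2, div_div_eq_mul_div]

theorem quantum_two : quantum 2 = (qHalf ^ 2 + 1) / qHalf := by
  have h0 := qHalf_ne_zero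
  have h1 := qHalf_sq_sub_one_ne_zero
  have h := quantum_natCast 2
  push_cast at h
  rw [h]
  field_simp
  ring

theorem quantum_two_ne_zero : quantum 2 ≠ 0 := by
  rw [quantum_two]
  exact div_ne_zero qHalf_sq_add_one_ne_zero qHalf_ne_zero

theorem quantum_two_mul (a : ℕ) : quantum (2 * a) = quantum 2 * quantum₂ a := by
  have h0 := qHalf_ne_zero
  have h1 := qHalf_sq_sub_one_ne_zero
  have h2 := qHalf_sq_add_one_ne_zero
  have h := quantum_natCast (2 * a)
  push_cast at h
  have h3 : qHalf ^ 2 - (qHalf ^ 2)⁻¹ = (qHalf ^ 2 - 1) * (qHalf ^ 2 + 1) / qHalf ^ 2 := by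
    field_simp
    ring
  rw [h, quantum_two, quantum₂, quantumAt, zpow_neg, zpow_natCast, h3, pow_mul]
  field_simp

theorem quantum_add (a b : ℕ) : quantum ((a : ℤ) + b) =
    (qHalf ^ a * qHalf ^ b - (qHalf ^ a * qHalf ^ b)⁻¹) * qHalf / (qHalf ^ 2 - 1) := by
  have := quantum_natCast (a + b)
  rw [pow_add] at this
  exact_mod_cast this

theorem quantum₂_natCast (a : ℕ) : quantum₂ a =
    ((qHalf ^ a) ^ 2 - ((qHalf ^ a) ^ 2)⁻¹) * qHalf ^ 2 / ((qHalf ^ 2 - 1) * (qHalf ^ 2 + 1)) := by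
  have h0 := qHalf_ne_zero
  have h1 := qHalf_sq_sub_one_ne_zero
  have h2 := qHalf_sq_add_one_ne_zero
  have h3 : qHalf ^ 2 - (qHalf ^ 2)⁻¹ = (qHalf ^ 2 - 1) * (qHalf ^ 2 + 1) / qHalf ^ 2 := by
    field_simp
    ring
  rw [quantum₂, quantumAt, zpow_neg, zpow_natCast, h3, div_div_eq_mul_div, ← pow_mul, ← pow_mul,
    mul_comm 2 a]

/-- With `t = qHalf`, one has `[k]₂ = [k](tᵏ + t⁻ᵏ)/[2]`; the identity is then the addition formula
`[a](tᵇ + t⁻ᵇ) + [b](tᵃ + t⁻ᵃ) = 2[a+b]` times `[a][b]/[2]`. -/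
theorem two_mul_edgePair (a b : ℕ) :
    2 * edgePair a b = quantum a ^ 2 * quantum₂ b + quantum b ^ 2 * quantum₂ a := by
  have h0 := qHalf_ne_zero
  have h1 := qHalf_sq_sub_one_ne_zero
  have h2 := qHalf_sq_add_one_ne_zero
  have ha : qHalf ^ a ≠ 0 := pow_ne_zero _ h0
  have hb : qHalf ^ b ≠ 0 := pow_ne_zero _ h0
  rw [edgePair, quantum_add, quantum_natCast, quantum_natCast, quantum_two, quantum₂_natCast,
    quantum₂_natCast]
  generalize qHalf ^ a = x at *
  generalize qHalf ^ b = y at *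
  generalize qHalf = t at *
  field_simp
  ring

/-- This is the previous identity evaluated at `(a + b, -b)`, since `[k]` and `[k]₂` are odd in `k`.
It compares the defect at a vertex crossed by edges of weights `a + b` and `b` with the pair factor
obtained after sliding. -/
theorem two_mul_edgePair_add (a b : ℕ) :
    2 * edgePair a b = quantum ((a + b : ℕ) : ℤ) ^ 2 * quantum₂ b -
      quantum b ^ 2 * quantum₂ ((a + b : ℕ) : ℤ) := by
  have h0 := qHalf_ne_zero
  have h1 := qHalf_sq_sub_one_ne_zero
  have h2 := qHalf_sq_add_one_ne_zero
  have ha : qHalf ^ a ≠ 0 := pow_ne_zero _ h0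
  have hb : qHalf ^ b ≠ 0 := pow_ne_zero _ h0
  rw [edgePair, quantum_add, quantum₂_natCast, quantum₂_natCast, quantum_natCast (a + b),
    quantum_natCast, quantum_natCast, quantum_two, pow_add]
  generalize qHalf ^ a = x at *
  generalize qHalf ^ b = y at *
  generalize qHalf = t at *
  field_simp
  ring

/-! ### Integrality -/

theorem qHalf_sq_mem : qHalf ^ 2 ∈ laurentQ := Algebra.subset_adjoin (by simp)

theorem qHalf_sq_zpow_mem (k : ℤ) : (qHalf ^ 2) ^ k ∈ laurentQ := by
  cases k with
  | ofNat k =>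
    rw [Int.ofNat_eq_natCast, zpow_natCast]
    exact pow_mem qHalf_sq_mem k
  | negSucc k =>
    rw [zpow_negSucc, ← inv_pow]
    exact pow_mem (Algebra.subset_adjoin (by simp)) _

theorem quantum₂_mem (a : ℕ) : quantum₂ a ∈ laurentQ := by
  have h0 := qHalf_ne_zero
  have h1 := qHalf_sq_sub_one_ne_zero
  have h2 := qHalf_sq_add_one_ne_zero
  induction a with
  | zero => simp [quantum₂, quantumAt]
  | succ a ih =>
    -- The recurrence `[a+1]₂ = q [a]₂ + q⁻ᵃ`.
    have : quantum₂ ((a + 1 : ℕ) : ℤ) = qHalf ^ 2 * quantum₂ a + (qHalf ^ 2) ^ (-(a : ℤ)) := by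
      have ha : qHalf ^ a ≠ 0 := pow_ne_zero _ h0
      rw [quantum₂_natCast, quantum₂_natCast, zpow_neg, zpow_natCast, pow_right_comm qHalf 2 a,
        pow_succ qHalf a]
      generalize qHalf ^ a = x at *
      generalize qHalf = t at *
      field_simp
      ring
    rw [this]
    exact add_mem (mul_mem qHalf_sq_mem ih) (qHalf_sq_zpow_mem _)

/-- The product is `1 + q + ⋯ + q^(a-1)`: only the prefactor of `[a]` can involve a half-integral
power of `q`. -/
theorem qHalf_zpow_mul_quantum_mem (a : ℕ) : qHalf ^ ((a : ℤ) - 1) * quantum a ∈ laurentQ := by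
  have h0 := qHalf_ne_zero
  have h1 := qHalf_sq_sub_one_ne_zero
  induction a with
  | zero => simp [quantum, quantumAt]
  | succ a ih =>
    have : qHalf ^ (((a + 1 : ℕ) : ℤ) - 1) * quantum ((a + 1 : ℕ) : ℤ) =
        qHalf ^ 2 * (qHalf ^ ((a : ℤ) - 1) * quantum a) + 1 := by
      have ha : qHalf ^ a ≠ 0 := pow_ne_zero _ h0
      rw [quantum_natCast, quantum_natCast, zpow_sub₀ h0, zpow_sub₀ h0, zpow_one, zpow_natCast,
        zpow_natCast, pow_succ qHalf a]
      generalize qHalf ^ a = x at *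
      generalize qHalf = t at *
      field_simp
      ring
    rw [this]
    exact add_mem (mul_mem qHalf_sq_mem ih) (one_mem _)

theorem quantum_mul_quantum_mem {a b : ℕ} (h : Even (a + b)) :
    quantum a * quantum b ∈ laurentQ := by
  have h0 := qHalf_ne_zero
  obtain ⟨k, hk⟩ := h
  have : quantum a * quantum b = (qHalf ^ 2) ^ (1 - (k : ℤ)) *
      ((qHalf ^ ((a : ℤ) - 1) * quantum a) * (qHalf ^ ((b : ℤ) - 1) * quantum b)) := by
    have h1 : (qHalf ^ 2) ^ (1 - (k : ℤ)) * (qHalf ^ ((a : ℤ) - 1) * qHalf ^ ((b : ℤ) - 1)) = 1 := by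
      rw [← zpow_natCast, ← zpow_mul, ← zpow_add₀ h0, ← zpow_add₀ h0, ← zpow_zero qHalf]
      congr 1
      push_cast
      omega
    linear_combination -(quantum a * quantum b) * h1
  rw [this]
  exact mul_mem (qHalf_sq_zpow_mem _)
    (mul_mem (qHalf_zpow_mul_quantum_mem a) (qHalf_zpow_mul_quantum_mem b))

theorem quantum_div_quantum_two_mem {a : ℕ} (h : Even a) : quantum a / quantum 2 ∈ laurentQ := by
  obtain ⟨k, rfl⟩ := h
  have := quantum_two_mul k
  rw [show ((k + k : ℕ) : ℤ) = 2 * k by push_cast; ring, this,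
    mul_div_cancel_left₀ _ quantum_two_ne_zero]
  exact quantum₂_mem k

/-- One of `a`, `b`, `a + b` is even, so its quantum integer is divisible by `[2]`. The other two
have the same parity, so the half-integral powers cancel in their product. -/
theorem edgePair_mem (a b : ℕ) : edgePair a b ∈ laurentQ := by
  have hc : quantum ((a : ℤ) + b) = quantum ((a + b : ℕ) : ℤ) := by push_cast; rfl
  rw [edgePair, hc]
  by_cases ha : Even a
  · have : quantum a * quantum b * quantum ((a + b : ℕ) : ℤ) / quantum 2 =
        quantum a / quantum 2 * (quantum b * quantum ((a + b : ℕ) : ℤ)) := by ring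
    rw [this]
    refine mul_mem (quantum_div_quantum_two_mem ha) (quantum_mul_quantum_mem ?_)
    rw [Nat.even_iff] at *
    omega
  by_cases hb : Even b
  · have : quantum a * quantum b * quantum ((a + b : ℕ) : ℤ) / quantum 2 =
        quantum b / quantum 2 * (quantum a * quantum ((a + b : ℕ) : ℤ)) := by ring
    rw [this]
    refine mul_mem (quantum_div_quantum_two_mem hb) (quantum_mul_quantum_mem ?_)
    rw [Nat.even_iff] at *
    omega
  · have : quantum a * quantum b * quantum ((a + b : ℕ) : ℤ) / quantum 2 =
        quantum ((a + b : ℕ) : ℤ) / quantum 2 * (quantum a * quantum b) := by ring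
    rw [this]
    refine mul_mem (quantum_div_quantum_two_mem ?_) (quantum_mul_quantum_mem ?_) <;>
    · rw [Nat.even_iff] at *
      omega

theorem Label.single_mem (x : Label) : x.single ∈ laurentQ := by
  rcases x with _ | _ | ⟨s, t, w⟩
  · exact one_mem _
  · exact one_mem _
  · change quantum w ^ 2 ∈ laurentQ
    rw [pow_two]
    exact quantum_mul_quantum_mem ⟨w, rfl⟩

theorem Label.paired_mem (x : Label) : x.paired ∈ laurentQ := by
  rcases x with _ | _ | ⟨s, t, w⟩
  · exact one_mem _
  · exact one_mem _
  · exact quantum₂_mem w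

theorem Label.share_mem (x y : Label) : x.share y ∈ laurentQ := by
  rcases x with _ | _ | ⟨s, t, w⟩ <;> rcases y with _ | _ | ⟨s', t', w'⟩ <;> simp only [Label.share]
  case edge.edge =>
    split_ifs
    · exact edgePair_mem w w'
    · exact zero_mem _
  all_goals exact zero_mem _

theorem Code.pairFactor_mem (c : Code) (j k : ℕ) : c.pairFactor j k ∈ laurentQ := by
  unfold Code.pairFactor
  split_ifs
  · exact mul_mem (Label.paired_mem _) (Label.paired_mem _)
  · exact Label.share_mem _ _

theorem Code.mult_mem (n : ℕ) (I : Finset ℕ) (c : Code) : c.mult n I ∈ laurentQ :=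
  mul_mem (prod_mem fun _ _ => Label.single_mem _) (prod_mem fun _ _ => c.pairFactor_mem _ _)

/-! ### Changing the marking -/

/-- Renumbering the end points of an edge. -/
def Label.relabel (σ : Equiv.Perm ℕ) : Label → Label
  | .out => .out
  | .vertex l r => .vertex l r
  | .edge s t w => .edge (s.map σ) (t.map σ) w

/-- Renumbering the positions. -/
def Code.act (σ : Equiv.Perm ℕ) (c : Code) : Code := fun k => (c (σ.symm k)).relabel σ

theorem MarkedFloorDiagram.step_of_step {Δ : Set (ℝ × ℝ)} {g : ℕ} (D : MarkedFloorDiagram Δ g)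
    {x y : D.V ⊕ D.E} (h : D.Step x y) : D.code.Step (D.m x) (D.m y) := by
  cases h with
  | enter e v h => exact (D.step_inr_inl e v).2 h
  | leave v e h => exact (D.step_inl_inr e v).2 h

/-- Keeping the diagram and composing the marking with `σ` gives a marking again as soon as `σ`
preserves the order along single steps, which generate the partial order. -/
theorem act_mem_codes {Δ : Set (ℝ × ℝ)} {g n : ℕ}
    (hn : ∀ D : MarkedFloorDiagram Δ g, D.numElts = n) {c : Code} (hc : c ∈ codes Δ g)
    (σ : Equiv.Perm ℕ) (hσ : ∀ k, σ k ∈ Set.Icc 1 n ↔ k ∈ Set.Icc 1 n)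
    (h : ∀ j k, c.Step j k → σ j < σ k) : c.act σ ∈ codes Δ g := by
  obtain ⟨D, rfl⟩ := hc
  have hinc : ∀ x y, D.Prec x y → (σ ∘ D.m) x < (σ ∘ D.m) y := by
    intro x y hxy
    induction hxy with
    | single h' => exact h _ _ (D.step_of_step h')
    | tail _ h' ih => exact ih.trans (h _ _ (D.step_of_step h'))
  have hσ' : Set.BijOn σ (Set.Icc 1 D.numElts) (Set.Icc 1 D.numElts) := by
    rw [hn D]
    refine ⟨fun k hk => (hσ k).2 hk, σ.injective.injOn, fun k hk => ⟨σ.symm k, ?_, by simp⟩⟩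
    rw [← hσ]
    simpa using hk
  let D' : MarkedFloorDiagram Δ g :=
    { toFloorDiagram := D.toFloorDiagram
      m := σ ∘ D.m
      m_bij := hσ'.comp D.m_bij
      m_increasing := hinc }
  refine ⟨D', D'.code_eq_of_label _ ?_ ?_⟩
  · intro x
    change (D.code (σ.symm (σ (D.m x)))).relabel σ = _
    rw [Equiv.symm_apply_apply, D.code_m]
    rcases x with v | e
    · rfl
    · change Label.edge (Option.map σ (Option.map D.pos (D.src e)))
        (Option.map σ (Option.map D.pos (D.tgt e))) (D.w e) =
        Label.edge ((D.src e).map D'.pos) ((D.tgt e).map D'.pos) (D.w e)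
      rw [Option.map_map, Option.map_map]
      rfl
  · intro k hk
    have : D.code (σ.symm k) = .out := by
      rw [D.code_eq_out_iff, hn D, ← hσ, Equiv.apply_symm_apply, ← hn D]
      exact hk
    rw [Code.act, this]
    rfl

/-! ### Modifying two edges -/

/-- The contribution of an edge to the divergence of a vertex. -/
def flow {V : Type} (s t : Option V) (w : ℕ) (v : V) : ℤ :=
  (if t = some v then (w : ℤ) else 0) - if s = some v then (w : ℤ) else 0

theorem WGraph.div_eq_sum_flow (Γ : WGraph) (v : Γ.V) :
    Γ.div v = ∑ e, flow (Γ.src e) (Γ.tgt e) (Γ.w e) v := by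
  simp only [WGraph.div, flow, Finset.sum_sub_distrib, Finset.sum_filter]

/-- The marking is kept, and its being increasing makes the new graph acyclic. Infinite edges stay
infinite of the same kind, so the genus is preserved once the graph stays connected. Through `hconn`
the connectedness has to be checked only at the old ends of the two modified edges. -/
theorem MarkedFloorDiagram.exists_modify {Δ : Set (ℝ × ℝ)} {g : ℕ} (D : MarkedFloorDiagram Δ g)
    (src' tgt' : D.E → Option D.V) (w' : D.E → ℕ) (e e' : D.E) (hne : e ≠ e')
    (hsame : ∀ x, x ≠ e → x ≠ e' → src' x = D.src x ∧ tgt' x = D.tgt x ∧ w' x = D.w x)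
    (hsn : ∀ x, src' x = none ↔ D.src x = none) (htn : ∀ x, tgt' x = none ↔ D.tgt x = none)
    (hw : ∀ x, 0 < w' x) (hinf : ∀ x, D.src x = none ∨ D.tgt x = none → w' x = 1)
    (hflow : ∀ v, flow (src' e) (tgt' e) (w' e) v + flow (src' e') (tgt' e') (w' e') v =
      flow (D.src e) (D.tgt e) (D.w e) v + flow (D.src e') (D.tgt e') (D.w e') v)
    (hs : ∀ x v, src' x = some v → D.pos v < D.m (Sum.inr x))
    (ht : ∀ x v, tgt' x = some v → D.m (Sum.inr x) < D.pos v)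
    (hconn : ∀ G : SimpleGraph D.V,
      (∀ x u v, src' x = some u → tgt' x = some v → G.Adj u v) →
      ∀ x u v, x = e ∨ x = e' → D.src x = some u → D.tgt x = some v → G.Reachable u v) :
    Function.update (Function.update D.code (D.m (Sum.inr e))
      (.edge ((src' e).map D.pos) ((tgt' e).map D.pos) (w' e))) (D.m (Sum.inr e'))
      (.edge ((src' e').map D.pos) ((tgt' e').map D.pos) (w' e')) ∈ codes Δ g := by
  let Γ : WGraph :=
    { V := D.V, E := D.E, src := src', tgt := tgt', w := w', w_pos := hw
      adjacent := fun x => by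
        rw [Ne, hsn, Ne, htn]
        exact D.adjacent x }
  have hstep : ∀ x y, Γ.Step x y → D.m x < D.m y := by
    intro x y h
    cases h with
    | enter x v h => exact ht x v h
    | leave v x h => exact hs x v h
  have hinc : ∀ x y, Γ.Prec x y → D.m x < D.m y := by
    intro x y h
    induction h with
    | single h => exact hstep _ _ h
    | tail _ h ih => exact ih.trans (hstep _ _ h)
  have hadj : ∀ x u v, src' x = some u → tgt' x = some v → Γ.underlying.Adj u v := by
    intro x u v hu hv
    refine (SimpleGraph.fromRel_adj _ _ _).2 ⟨?_, Or.inl ⟨x, hu, hv⟩⟩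
    -- A loop would have to be marked both before and after its vertex.
    rintro rfl
    have h1 := hs x u hu
    have h2 := ht x u hv
    omega
  have hreach : ∀ x u v, D.src x = some u → D.tgt x = some v → Γ.underlying.Reachable u v := by
    intro x u v hu hv
    by_cases hx : x = e ∨ x = e'
    · exact hconn _ hadj x u v hx hu hv
    · rw [not_or] at hx
      obtain ⟨h1, h2, -⟩ := hsame x hx.1 hx.2
      exact (hadj x u v (h1.trans hu) (h2.trans hv)).reachable
  have hcon : Γ.IsConnected := by
    have hD := D.connected
    have : Nonempty Γ.V := hD.nonempty
    refine SimpleGraph.Connected.mk fun u v => ?_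
    have huv := (SimpleGraph.reachable_iff_reflTransGen u v).1 (hD.preconnected u v)
    induction huv with
    | refl => exact SimpleGraph.Reachable.refl _
    | tail _ h ih =>
      refine ih.trans ?_
      obtain ⟨-, ⟨x, hx, hx'⟩ | ⟨x, hx, hx'⟩⟩ := (SimpleGraph.fromRel_adj _ _ _).1 h
      · exact hreach x _ _ hx hx'
      · exact (hreach x _ _ hx hx').symm
  have hdiv : ∀ v, Γ.div v = D.div v := by
    intro v
    rw [WGraph.div_eq_sum_flow, WGraph.div_eq_sum_flow]
    change ∑ x : D.E, flow (src' x) (tgt' x) (w' x) v = _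
    rw [← Finset.add_sum_erase _ _ (Finset.mem_univ e),
      ← Finset.add_sum_erase _ _ (show e' ∈ Finset.univ.erase e by simp [hne.symm]),
      ← Finset.add_sum_erase (Finset.univ : Finset D.E) (fun x => flow (D.src x) (D.tgt x) (D.w x) v)
        (Finset.mem_univ e),
      ← Finset.add_sum_erase (Finset.univ.erase e) (fun x => flow (D.src x) (D.tgt x) (D.w x) v)
        (show e' ∈ Finset.univ.erase e by simp [hne.symm]), ← add_assoc, ← add_assoc, hflow v]
    congr 1
    refine Finset.sum_congr rfl fun x hx => ?_
    simp only [Finset.mem_erase] at hx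
    obtain ⟨h1, h2, h3⟩ := hsame x hx.2.1 hx.1
    rw [h1, h2, h3]
  have hbd : Γ.boundedEdges = D.boundedEdges := by
    ext x
    simp only [WGraph.boundedEdges, Finset.mem_filter, Finset.mem_univ, true_and]
    exact and_congr (not_congr (hsn x)) (not_congr (htn x))
  let D' : MarkedFloorDiagram Δ g :=
    { toWGraph := Γ
      connected := hcon
      acyclic := fun x hx => lt_irrefl _ (hinc x x hx)
      genus_eq := by
        have := D.genus_eq
        unfold WGraph.genus at this ⊢
        rw [D.connected.card_connectedComponent] at this
        rw [hcon.card_connectedComponent, hbd]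
        exact this
      card_vertices := D.card_vertices
      card_sinks := by
        rw [← D.card_sinks]
        congr 1
        ext x
        simp only [WGraph.sinks, Finset.mem_filter, Finset.mem_univ, true_and]
        exact htn x
      card_sources := by
        rw [← D.card_sources]
        congr 1
        ext x
        simp only [WGraph.sources, Finset.mem_filter, Finset.mem_univ, true_and]
        exact hsn x
      weight_infinite := fun x hx => hinf x (hx.imp (hsn x).1 (htn x).1)
      L := D.L
      R := D.R
      L_bij := D.L_bij
      R_bij := D.R_bij
      div_eq := fun v => (hdiv v).trans (D.div_eq v)
      m := D.m
      m_bij := D.m_bij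
      m_increasing := hinc }
  refine ⟨D', D'.code_eq_of_label _ ?_ ?_⟩
  · rintro (v | x)
    · have h1 := D.pos_ne_m_inr v e
      have h2 := D.pos_ne_m_inr v e'
      change Function.update (β := fun _ => Label) _ _ _ (D.pos v) = _
      rw [Function.update_of_ne h2, Function.update_of_ne h1, D.code_pos]
      rfl
    · change Function.update (β := fun _ => Label) _ _ _ (D.m (Sum.inr x)) =
        Label.edge ((src' x).map D.pos) ((tgt' x).map D.pos) (w' x)
      by_cases hx' : x = e'
      · subst hx'
        rw [Function.update_self]
      have h2 : D.m (Sum.inr x) ≠ D.m (Sum.inr e') := D.m_injective.ne (by simpa using hx')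
      rw [Function.update_of_ne h2]
      by_cases hx : x = e
      · subst hx
        rw [Function.update_self]
      have h1 : D.m (Sum.inr x) ≠ D.m (Sum.inr e) := D.m_injective.ne (by simpa using hx)
      obtain ⟨h3, h4, h5⟩ := hsame x hx hx'
      rw [Function.update_of_ne h1, D.code_inr, h3, h4, h5]
  · intro k hk
    have hk' : k ∉ Set.Icc 1 D.numElts := hk
    rw [Function.update_of_ne, Function.update_of_ne, D.code_eq_out_iff]
    · exact hk'
    · rintro rfl
      exact hk' (D.m_mem _)
    · rintro rfl
      exact hk' (D.m_mem _)

/-- Sliding the origin of an edge along a bounded edge from `u` to `v`. -/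
theorem slide_src_mem_codes {Δ : Set (ℝ × ℝ)} {g : ℕ} {c : Code} (hc : c ∈ codes Δ g)
    {p p' u v y y' x x' b : ℕ} {t : Option ℕ} (hp : c p = .edge (some u) (some v) x)
    (hp' : c p' = .edge (some y) t b) (hne : p ≠ p') (hvp : v < p') (hx' : 0 < x')
    (h : (y = u ∧ y' = v ∧ x' = x + b) ∨ (y = v ∧ y' = u ∧ x = x' + b)) :
    Function.update (Function.update c p (.edge (some u) (some v) x')) p'
      (.edge (some y') t b) ∈ codes Δ g := by
  obtain ⟨D, rfl⟩ := hc
  obtain ⟨e, rfl, hsu, htv, rfl⟩ := D.code_eq_edge hp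
  obtain ⟨e', rfl, hsy, rfl, rfl⟩ := D.code_eq_edge hp'
  obtain ⟨u, hu, rfl⟩ := Option.map_eq_some_iff.1 hsu
  obtain ⟨v, hv, rfl⟩ := Option.map_eq_some_iff.1 htv
  obtain ⟨y, hy, rfl⟩ := Option.map_eq_some_iff.1 hsy
  have hee : e ≠ e' := fun h => hne (by rw [h])
  have huv : D.pos u < D.pos v := (D.m_lt_of_src hu).trans (D.m_lt_of_tgt hv)
  -- `z` is the new origin of the sliding edge. The two alternatives are the two inverse directions
  -- of sliding, treated together.
  obtain ⟨z, rfl, hz⟩ : ∃ z, D.pos z = y' ∧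
      ((y = u ∧ z = v ∧ x' = D.w e + D.w e') ∨ (y = v ∧ z = u ∧ D.w e = x' + D.w e')) := by
    rcases h with ⟨h1, rfl, h2⟩ | ⟨h1, rfl, h2⟩
    · exact ⟨v, rfl, Or.inl ⟨D.pos_injective h1, rfl, h2⟩⟩
    · exact ⟨u, rfl, Or.inr ⟨D.pos_injective h1, rfl, h2⟩⟩
  have key := D.exists_modify (Function.update D.src e' (some z)) D.tgt (Function.update D.w e x')
    e e' hee ?_ ?_ ?_ ?_ ?_ ?_ ?_ ?_ ?_
  · rw [Function.update_of_ne hee, Function.update_self, Function.update_self,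
      Function.update_of_ne hee.symm, hu, hv] at key
    exact key
  · intro a ha ha'
    rw [Function.update_of_ne ha', Function.update_of_ne ha]
    exact ⟨rfl, rfl, rfl⟩
  · intro a
    by_cases ha : a = e'
    · subst ha
      simp [hy]
    · rw [Function.update_of_ne ha]
  · exact fun _ => Iff.rfl
  · intro a
    by_cases ha : a = e
    · subst ha
      simpa using hx'
    · rw [Function.update_of_ne ha]
      exact D.w_pos a
  · intro a ha'
    have ha : a ≠ e := by
      rintro rfl
      simp [hu, hv] at ha'
    rw [Function.update_of_ne ha]
    exact D.weight_infinite a ha'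
  · intro a
    rw [Function.update_of_ne hee, Function.update_self, Function.update_self,
      Function.update_of_ne hee.symm, hu, hv, hy]
    have hcast : (y = u ∧ z = v ∧ (x' : ℤ) = D.w e + D.w e') ∨
        (y = v ∧ z = u ∧ (D.w e : ℤ) = x' + D.w e') := by exact_mod_cast hz
    unfold flow
    rcases hcast with ⟨rfl, rfl, h₀⟩ | ⟨rfl, rfl, h₀⟩ <;> rw [h₀] <;> split_ifs <;> ring
  · intro a q hq
    by_cases ha : a = e'
    · subst ha
      rw [Function.update_self, Option.some.injEq] at hq
      subst hq
      rcases hz with ⟨-, rfl, -⟩ | ⟨-, rfl, -⟩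
      · exact hvp
      · exact huv.trans hvp
    · rw [Function.update_of_ne ha] at hq
      exact D.m_lt_of_src hq
  · exact fun a q hq => D.m_lt_of_tgt hq
  -- The edge from `u` to `v` survives, so the old ends of the sliding edge are joined through it
  -- and the new edge.
  · intro G hG a q r ha hq hr
    have h1 : G.Adj u v := hG e u v (by rw [Function.update_of_ne hee, hu]) hv
    rcases ha with rfl | rfl
    · rw [hu, Option.some.injEq] at hq
      rw [hv, Option.some.injEq] at hr
      subst hq hr
      exact h1.reachable
    · rw [hy, Option.some.injEq] at hq
      subst hq
      have h2 : G.Adj z r := hG a z r (Function.update_self ..) hr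
      rcases hz with ⟨rfl, rfl, -⟩ | ⟨rfl, rfl, -⟩
      · exact h1.reachable.trans h2.reachable
      · exact h1.symm.reachable.trans h2.reachable

/-- Sliding the end of an edge along a bounded edge from `u` to `v`. -/
theorem slide_tgt_mem_codes {Δ : Set (ℝ × ℝ)} {g : ℕ} {c : Code} (hc : c ∈ codes Δ g)
    {p p' u v y y' x x' a : ℕ} {s : Option ℕ} (hp : c p = .edge s (some y) a)
    (hp' : c p' = .edge (some u) (some v) x) (hne : p ≠ p') (hpu : p < u) (hx' : 0 < x')
    (h : (y = v ∧ y' = u ∧ x' = x + a) ∨ (y = u ∧ y' = v ∧ x = x' + a)) :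
    Function.update (Function.update c p (.edge s (some y') a)) p'
      (.edge (some u) (some v) x') ∈ codes Δ g := by
  obtain ⟨D, rfl⟩ := hc
  obtain ⟨e, rfl, rfl, hty, rfl⟩ := D.code_eq_edge hp
  obtain ⟨e', rfl, hsu, htv, rfl⟩ := D.code_eq_edge hp'
  obtain ⟨u, hu, rfl⟩ := Option.map_eq_some_iff.1 hsu
  obtain ⟨v, hv, rfl⟩ := Option.map_eq_some_iff.1 htv
  obtain ⟨y, hy, rfl⟩ := Option.map_eq_some_iff.1 hty
  have hee : e ≠ e' := fun h => hne (by rw [h])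
  have huv : D.pos u < D.pos v := (D.m_lt_of_src hu).trans (D.m_lt_of_tgt hv)
  obtain ⟨z, rfl, hz⟩ : ∃ z, D.pos z = y' ∧
      ((y = v ∧ z = u ∧ x' = D.w e' + D.w e) ∨ (y = u ∧ z = v ∧ D.w e' = x' + D.w e)) := by
    rcases h with ⟨h1, rfl, h2⟩ | ⟨h1, rfl, h2⟩
    · exact ⟨u, rfl, Or.inl ⟨D.pos_injective h1, rfl, h2⟩⟩
    · exact ⟨v, rfl, Or.inr ⟨D.pos_injective h1, rfl, h2⟩⟩
  have key := D.exists_modify D.src (Function.update D.tgt e (some z)) (Function.update D.w e' x')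
    e e' hee ?_ ?_ ?_ ?_ ?_ ?_ ?_ ?_ ?_
  · rw [Function.update_of_ne hee, Function.update_self, Function.update_self,
      Function.update_of_ne hee.symm, hu, hv] at key
    exact key
  · intro b hb hb'
    rw [Function.update_of_ne hb', Function.update_of_ne hb]
    exact ⟨rfl, rfl, rfl⟩
  · exact fun _ => Iff.rfl
  · intro b
    by_cases hb : b = e
    · subst hb
      simp [hy]
    · rw [Function.update_of_ne hb]
  · intro b
    by_cases hb : b = e'
    · subst hb
      simpa using hx'
    · rw [Function.update_of_ne hb]
      exact D.w_pos b
  · intro b hb'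
    have hb : b ≠ e' := by
      rintro rfl
      simp [hu, hv] at hb'
    rw [Function.update_of_ne hb]
    exact D.weight_infinite b hb'
  · intro b
    rw [Function.update_of_ne hee, Function.update_self, Function.update_self,
      Function.update_of_ne hee.symm, hu, hv, hy]
    have hcast : (y = v ∧ z = u ∧ (x' : ℤ) = D.w e' + D.w e) ∨
        (y = u ∧ z = v ∧ (D.w e' : ℤ) = x' + D.w e) := by exact_mod_cast hz
    unfold flow
    rcases hcast with ⟨rfl, rfl, h₀⟩ | ⟨rfl, rfl, h₀⟩ <;> rw [h₀] <;> split_ifs <;> ring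
  · exact fun b q hq => D.m_lt_of_src hq
  · intro b q hq
    by_cases hb : b = e
    · subst hb
      rw [Function.update_self, Option.some.injEq] at hq
      subst hq
      rcases hz with ⟨-, rfl, -⟩ | ⟨-, rfl, -⟩
      · exact hpu
      · exact hpu.trans huv
    · rw [Function.update_of_ne hb] at hq
      exact D.m_lt_of_tgt hq
  · intro G hG b q r hb hq hr
    have h1 : G.Adj u v := hG e' u v hu (by rw [Function.update_of_ne hee.symm, hv])
    rcases hb with rfl | rfl
    · rw [hy, Option.some.injEq] at hr
      subst hr
      have h2 : G.Adj q z := hG b q z hq (Function.update_self ..)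
      rcases hz with ⟨rfl, rfl, -⟩ | ⟨rfl, rfl, -⟩
      · exact h2.reachable.trans h1.reachable
      · exact h2.reachable.trans h1.symm.reachable
    · rw [hu, Option.some.injEq] at hq
      rw [hv, Option.some.injEq] at hr
      subst hq hr
      exact h1.reachable

/-! ### Equivariance -/

namespace Label

variable (σ : Equiv.Perm ℕ)

theorem single_relabel (x : Label) : (x.relabel σ).single = x.single := by cases x <;> rfl

theorem paired_relabel (x : Label) : (x.relabel σ).paired = x.paired := by cases x <;> rfl

theorem share_relabel (x y : Label) : (x.relabel σ).share (y.relabel σ) = x.share y := by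
  rcases x with _ | _ | ⟨s, t, w⟩ <;> rcases y with _ | _ | ⟨s', t', w'⟩ <;> try rfl
  simp only [relabel, share, (Option.map_injective σ.injective).eq_iff, ne_eq,
    Option.map_eq_none_iff]

theorem relabel_relabel (hσ : ∀ k, σ (σ k) = k) (x : Label) : (x.relabel σ).relabel σ = x := by
  have h : σ ∘ σ = id := funext hσ
  cases x <;> simp [relabel, Option.map_map, h]

end Label

namespace Code

/-- The element at `j` is an edge entering the element at `k`. -/
def Enters (c : Code) (j k : ℕ) : Prop := ∃ s w, c j = .edge s (some k) w

/-- The element at `k` is an edge leaving the element at `j`. -/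
def Leaves (c : Code) (j k : ℕ) : Prop := ∃ t w, c k = .edge (some j) t w

variable (σ : Equiv.Perm ℕ) (c : Code)

theorem act_apply (k : ℕ) : c.act σ (σ k) = (c k).relabel σ := by
  rw [act, Equiv.symm_apply_apply]

theorem act_act (hσ : ∀ k, σ (σ k) = k) : (c.act σ).act σ = c := by
  funext k
  have h : σ.symm (σ.symm k) = k := by
    rw [Equiv.symm_apply_eq, Equiv.symm_apply_eq, hσ]
  rw [act, act, h, Label.relabel_relabel σ hσ]

theorem enters_act (j k : ℕ) : (c.act σ).Enters (σ j) (σ k) ↔ c.Enters j k := by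
  unfold Enters
  rw [act_apply]
  cases c j <;> simp [Label.relabel]

theorem leaves_act (j k : ℕ) : (c.act σ).Leaves (σ j) (σ k) ↔ c.Leaves j k := by
  unfold Leaves
  rw [act_apply]
  cases c k <;> simp [Label.relabel]

theorem step_act (j k : ℕ) : (c.act σ).Step (σ j) (σ k) ↔ c.Step j k :=
  or_congr (enters_act σ c j k) (leaves_act σ c j k)

theorem pairFactor_act (j k : ℕ) :
    (c.act σ).pairFactor (σ j) (σ k) = c.pairFactor j k := by
  simp only [pairFactor, step_act, act_apply, Label.paired_relabel, Label.share_relabel]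

variable {c} {n : ℕ}

theorem WF.lt_of_step (hc : c.WF) {j k : ℕ} (h : c.Step j k) : j < k := by
  rcases h with ⟨s, w, h⟩ | ⟨t, w, h⟩
  · exact (hc.lt_tgt h).1
  · exact (hc.src_lt h).1

theorem pairFactor_of_step {j k : ℕ} (hs : c.Step j k) :
    c.pairFactor j k = (c j).paired * (c k).paired := if_pos (Or.inl hs)

theorem WF.pairFactor_of_not_step (hc : c.WF) {j k : ℕ} (hjk : j < k) (hs : ¬ c.Step j k) :
    c.pairFactor j k = (c j).share (c k) := by
  refine if_neg ?_
  rintro (h | h)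
  · exact hs h
  · exact absurd (hc.lt_of_step h) (by omega)

/-! ### The contribution of the other elements -/

variable (n) (J : Finset ℕ) (i : ℕ)

/-- The contribution to the multiplicity of the elements outside `i`, `i + 1`, `i + 2`. -/
def rest (c : Code) : RatFunc ℚ :=
  (∏ k ∈ Finset.Icc 1 n \ (cover J ∪ {i, i + 1, i + 2}), (c k).single) *
    ∏ j ∈ J, c.pairFactor j (j + 1)

/-- The difference of the multiplicities for the pairs `{i, i + 1}` and `{i + 1, i + 2}`. -/
def defect (c : Code) : RatFunc ℚ :=
  c.rest n J i * (c.pairFactor i (i + 1) * (c (i + 2)).single -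
    c.pairFactor (i + 1) (i + 2) * (c i).single)

variable {n J i}

/-- The two multiplicities share the factors in `rest`; they differ only by which two of the three
positions are paired and whether `i + 2` or `i` is left single. -/
theorem mult_sub_mult (hi : 1 ≤ i) (hn : i + 2 ≤ n) (hJ : ∀ j ∈ J, j + 1 < i ∨ i + 2 < j)
    (c : Code) : c.mult n (insert i J) - c.mult n (insert (i + 1) J) = c.defect n J i := by
  have h1 : i ∉ J := fun h => by have := hJ i h; omega
  have h2 : i + 1 ∉ J := fun h => by have := hJ _ h; omega
  have hcov : ∀ k ∈ cover J, k < i ∨ i + 2 < k := by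
    intro k hk
    rw [cover, Finset.mem_union, Finset.mem_image] at hk
    rcases hk with hk | ⟨j, hj, rfl⟩
    · have := hJ k hk
      omega
    · have := hJ j hj
      omega
  have hins : ∀ l k, k ∈ cover (insert l J) ↔ k = l ∨ k = l + 1 ∨ k ∈ cover J := by
    intro l k
    simp only [cover, Finset.image_insert, Finset.mem_union, Finset.mem_insert]
    tauto
  have e1 : Finset.Icc 1 n \ cover (insert i J) =
      insert (i + 2) (Finset.Icc 1 n \ (cover J ∪ {i, i + 1, i + 2})) := by
    ext k
    rw [Finset.mem_sdiff, hins, Finset.mem_insert, Finset.mem_sdiff, Finset.mem_union]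
    simp only [Finset.mem_Icc, Finset.mem_insert, Finset.mem_singleton]
    by_cases hk : k ∈ cover J
    · have := hcov k hk
      simp only [hk, or_true, true_or, not_true_eq_false, and_false, or_false, false_iff]
      omega
    · simp only [hk, or_false, false_or]
      omega
  have e2 : Finset.Icc 1 n \ cover (insert (i + 1) J) =
      insert i (Finset.Icc 1 n \ (cover J ∪ {i, i + 1, i + 2})) := by
    ext k
    rw [Finset.mem_sdiff, hins, Finset.mem_insert, Finset.mem_sdiff, Finset.mem_union]
    simp only [Finset.mem_Icc, Finset.mem_insert, Finset.mem_singleton]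
    by_cases hk : k ∈ cover J
    · have := hcov k hk
      simp only [hk, or_true, true_or, not_true_eq_false, and_false, or_false, false_iff]
      omega
    · simp only [hk, or_false, false_or]
      omega
  rw [mult, mult, e1, e2, Finset.prod_insert h1, Finset.prod_insert (by simp),
    Finset.prod_insert (by simp), Finset.prod_insert h2, defect, rest]
  ring

theorem rest_congr (hJ : ∀ j ∈ J, j + 1 < i ∨ i + 2 < j) {c c' : Code}
    (h : ∀ k, k ≠ i → k ≠ i + 1 → k ≠ i + 2 → c k = c' k) : c.rest n J i = c'.rest n J i := by
  unfold rest
  congr 1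
  · refine Finset.prod_congr rfl fun k hk => ?_
    simp only [Finset.mem_sdiff, Finset.mem_union, Finset.mem_insert, Finset.mem_singleton,
      not_or] at hk
    rw [h k hk.2.2.1 hk.2.2.2.1 hk.2.2.2.2]
  · refine Finset.prod_congr rfl fun j hj => ?_
    have := hJ j hj
    have h1 := h j (by omega) (by omega) (by omega)
    have h2 := h (j + 1) (by omega) (by omega) (by omega)
    have h3 : c.Step j (j + 1) ↔ c'.Step j (j + 1) := by simp only [Step, h1, h2]
    have h4 : c.Step (j + 1) j ↔ c'.Step (j + 1) j := by simp only [Step, h1, h2]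
    simp only [pairFactor, h1, h2, h3, h4]

theorem rest_act (hJ : ∀ j ∈ J, j + 1 < i ∨ i + 2 < j) (σ : Equiv.Perm ℕ)
    (hσ : ∀ k, k ≠ i → k ≠ i + 1 → k ≠ i + 2 → σ k = k) (c : Code) :
    (c.act σ).rest n J i = c.rest n J i := by
  unfold rest
  congr 1
  · refine Finset.prod_congr rfl fun k hk => ?_
    simp only [Finset.mem_sdiff, Finset.mem_union, Finset.mem_insert, Finset.mem_singleton,
      not_or] at hk
    have h := act_apply σ c k
    rw [hσ k hk.2.2.1 hk.2.2.2.1 hk.2.2.2.2] at h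
    rw [h, Label.single_relabel]
  · refine Finset.prod_congr rfl fun j hj => ?_
    have := hJ j hj
    have h := pairFactor_act σ c j (j + 1)
    rwa [hσ j (by omega) (by omega) (by omega),
      hσ (j + 1) (by omega) (by omega) (by omega)] at h

/-- The defect after moving the elements at `x`, `y`, `z` to `i`, `i + 1`, `i + 2`. -/
theorem defect_act (hJ : ∀ j ∈ J, j + 1 < i ∨ i + 2 < j) {σ : Equiv.Perm ℕ} {x y z : ℕ}
    (hσ : ∀ k, k ≠ i → k ≠ i + 1 → k ≠ i + 2 → σ k = k) (hx : σ x = i) (hy : σ y = i + 1)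
    (hz : σ z = i + 2) (c : Code) :
    (c.act σ).defect n J i = c.rest n J i * (c.pairFactor x y * (c z).single -
      c.pairFactor y z * (c x).single) := by
  rw [defect, rest_act hJ σ hσ, ← pairFactor_act σ c x y, ← pairFactor_act σ c y z,
    ← Label.single_relabel σ (c z), ← Label.single_relabel σ (c x), ← act_apply, ← act_apply,
    hx, hy, hz]

end Code

/-! ### Exchanging neighbouring elements -/

variable {Δ : Set (ℝ × ℝ)} {g n : ℕ}

theorem Code.enters_act_iff (σ : Equiv.Perm ℕ) (c : Code) (j k : ℕ) :
    (c.act σ).Enters j k ↔ c.Enters (σ.symm j) (σ.symm k) := by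
  rw [← Code.enters_act σ c (σ.symm j), Equiv.apply_symm_apply, Equiv.apply_symm_apply]

theorem Code.step_act_iff (σ : Equiv.Perm ℕ) (c : Code) (j k : ℕ) :
    (c.act σ).Step j k ↔ c.Step (σ.symm j) (σ.symm k) := by
  rw [← Code.step_act σ c (σ.symm j), Equiv.apply_symm_apply, Equiv.apply_symm_apply]

theorem wf_of_mem_codes {c : Code} (hc : c ∈ codes Δ g) : c.WF := by
  obtain ⟨D, rfl⟩ := hc
  exact D.code_wf

/-- A transposition keeps `[a, b]` globally fixed, so it can only reverse steps inside this
interval, and not those avoiding both `a` and `b`. -/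
theorem swap_mem_codes (hn : ∀ D : MarkedFloorDiagram Δ g, D.numElts = n) {c : Code}
    (hc : c ∈ codes Δ g) {a b : ℕ} (ha : 1 ≤ a) (hab : a < b) (hb : b ≤ n)
    (h : ∀ j k, a ≤ j → j < k → k ≤ b → ¬ c.Step j k ∨ (a < j ∧ k < b)) :
    c.act (Equiv.swap a b) ∈ codes Δ g := by
  refine act_mem_codes hn hc _ ?_ ?_
  · intro k
    simp only [Equiv.swap_apply_def, Set.mem_Icc]
    split_ifs <;> omega
  · intro j k hjk
    have h1 := (wf_of_mem_codes hc).lt_of_step hjk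
    have h2 : a ≤ j → k ≤ b → a < j ∧ k < b := fun h3 h4 =>
      (h j k h3 h1 h4).resolve_left (not_not_intro hjk)
    simp only [Equiv.swap_apply_def]
    split_ifs <;> omega

theorem sum_filter_act {C : Finset Code} {σ : Equiv.Perm ℕ} (hσ : ∀ k, σ (σ k) = k)
    {P Q : Code → Prop} [DecidablePred P] [DecidablePred Q]
    (hPQ : ∀ c ∈ C, P c → c.act σ ∈ C ∧ Q (c.act σ))
    (hQP : ∀ c ∈ C, Q c → c.act σ ∈ C ∧ P (c.act σ)) (f : Code → RatFunc ℚ) :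
    ∑ c ∈ C.filter Q, f c = ∑ c ∈ C.filter P, f (c.act σ) := by
  refine Finset.sum_nbij' (Code.act σ) (Code.act σ) ?_ ?_ ?_ ?_ ?_
  · intro c hc
    rw [Finset.mem_filter] at hc ⊢
    exact hQP c hc.1 hc.2
  · intro c hc
    rw [Finset.mem_filter] at hc ⊢
    exact hPQ c hc.1 hc.2
  · exact fun c _ => c.act_act σ hσ
  · exact fun c _ => c.act_act σ hσ
  · intro c _
    rw [c.act_act σ hσ]

theorem eq_zero_of_add_self {x : RatFunc ℚ} (h : x + x = 0) : x = 0 := by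
  have h2 : (2 : RatFunc ℚ) ≠ 0 := two_ne_zero
  exact (mul_eq_zero.1 ((two_mul x).trans h)).resolve_left h2

/-- Reindexing by the involution shows that twice the sum is zero. Possible fixed points cause no
trouble in characteristic zero. -/
theorem sum_filter_eq_zero {C : Finset Code} {σ : Equiv.Perm ℕ} (hσ : ∀ k, σ (σ k) = k)
    {P : Code → Prop} [DecidablePred P] (hP : ∀ c ∈ C, P c → c.act σ ∈ C ∧ P (c.act σ))
    {f : Code → RatFunc ℚ} (hf : ∀ c ∈ C, P c → f (c.act σ) + f c = 0) :
    ∑ c ∈ C.filter P, f c = 0 := by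
  apply eq_zero_of_add_self
  conv_lhs =>
    enter [1]
    rw [sum_filter_act hσ hP hP]
  rw [← Finset.sum_add_distrib]
  refine Finset.sum_eq_zero fun c hc => ?_
  rw [Finset.mem_filter] at hc
  exact hf c hc.1 hc.2

/-- The codes as a finite set. -/
def codeFinset (Δ : Set (ℝ × ℝ)) (g : ℕ) : Finset Code := (codes_finite Δ g).toFinset

theorem mem_codeFinset {c : Code} : c ∈ codeFinset Δ g ↔ c ∈ codes Δ g :=
  (codes_finite Δ g).mem_toFinset

/-- Three consecutive positions `i`, `i + 1`, `i + 2` that are not covered by the pairs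
`{j, j + 1}`, `j ∈ J`. -/
structure Exchangeable (Δ : Set (ℝ × ℝ)) (g n i : ℕ) (J : Finset ℕ) : Prop where
  numElts_eq : ∀ D : MarkedFloorDiagram Δ g, D.numElts = n
  one_le : 1 ≤ i
  le_n : i + 2 ≤ n
  notMem : ∀ j ∈ J, j + 1 < i ∨ i + 2 < j

theorem swap_left_mid (i : ℕ) : Equiv.swap i (i + 1) (i + 2) = i + 2 :=
  Equiv.swap_apply_of_ne_of_ne (by omega) (by omega)

theorem swap_mid_right (i : ℕ) : Equiv.swap (i + 1) (i + 2) i = i :=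
  Equiv.swap_apply_of_ne_of_ne (by omega) (by omega)

theorem swap_left_right (i : ℕ) : Equiv.swap i (i + 2) (i + 1) = i + 1 :=
  Equiv.swap_apply_of_ne_of_ne (by omega) (by omega)

namespace Exchangeable

variable {i : ℕ} {J : Finset ℕ} {c : Code}

theorem wf_of_mem_codeFinset (hc : c ∈ codeFinset Δ g) : c.WF :=
  wf_of_mem_codes (mem_codeFinset.1 hc)

theorem not_step_of_lt (hc : c ∈ codeFinset Δ g) {j k : ℕ} (hjk : j < k) :
    ¬ c.Step k j := fun h' => by
  have := (wf_of_mem_codeFinset hc).lt_of_step h'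
  omega

theorem swap_left_mid_mem (h : Exchangeable Δ g n i J) (hc : c ∈ codeFinset Δ g)
    (hs : ¬ c.Step i (i + 1)) : c.act (Equiv.swap i (i + 1)) ∈ codeFinset Δ g := by
  rw [mem_codeFinset] at *
  have := h.le_n
  refine swap_mem_codes h.numElts_eq hc h.one_le (by omega) (by omega) fun j k h1 h2 h3 => ?_
  obtain rfl : j = i := by omega
  obtain rfl : k = j + 1 := by omega
  exact Or.inl hs

theorem swap_mid_right_mem (h : Exchangeable Δ g n i J) (hc : c ∈ codeFinset Δ g)
    (hs : ¬ c.Step (i + 1) (i + 2)) : c.act (Equiv.swap (i + 1) (i + 2)) ∈ codeFinset Δ g := by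
  rw [mem_codeFinset] at *
  have := h.le_n
  refine swap_mem_codes h.numElts_eq hc (by omega) (by omega) (by omega) fun j k h1 h2 h3 => ?_
  obtain rfl : j = i + 1 := by omega
  obtain rfl : k = i + 2 := by omega
  exact Or.inl hs

theorem swap_left_right_mem (h : Exchangeable Δ g n i J) (hc : c ∈ codeFinset Δ g)
    (h12 : ¬ c.Step i (i + 1)) (h13 : ¬ c.Step i (i + 2)) (h23 : ¬ c.Step (i + 1) (i + 2)) :
    c.act (Equiv.swap i (i + 2)) ∈ codeFinset Δ g := by
  rw [mem_codeFinset] at *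
  have := h.le_n
  refine swap_mem_codes h.numElts_eq hc h.one_le (by omega) (by omega) fun j k h1 h2 h3 => ?_
  have : j = i ∧ k = i + 1 ∨ j = i ∧ k = i + 2 ∨ j = i + 1 ∧ k = i + 2 := by omega
  rcases this with ⟨rfl, rfl⟩ | ⟨rfl, rfl⟩ | ⟨rfl, rfl⟩
  · exact Or.inl h12
  · exact Or.inl h13
  · exact Or.inl h23

theorem swap_fixes {a b : ℕ} (ha : i ≤ a) (hab : a < b) (hb : b ≤ i + 2) (k : ℕ) (h1 : k ≠ i)
    (h2 : k ≠ i + 1) (h3 : k ≠ i + 2) : Equiv.swap a b k = k :=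
  Equiv.swap_apply_of_ne_of_ne (by omega) (by omega)

/-- This and the next four lemmas express the defects of the rearrangements of a triple through the
factors of the single code `c`, so that sums over rearrangements become algebraic identities. -/
theorem defect_swap_left_mid (h : Exchangeable Δ g n i J) (c : Code) :
    (c.act (Equiv.swap i (i + 1))).defect n J i =
      c.rest n J i * (c.pairFactor i (i + 1) * (c (i + 2)).single -
        c.pairFactor i (i + 2) * (c (i + 1)).single) := by
  rw [Code.defect_act h.notMem (swap_fixes le_rfl (by omega) (by omega))
    (Equiv.swap_apply_right _ _) (Equiv.swap_apply_left _ _) (swap_left_mid i),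
    c.pairFactor_comm (i + 1)]

theorem defect_swap_mid_right (h : Exchangeable Δ g n i J) (c : Code) :
    (c.act (Equiv.swap (i + 1) (i + 2))).defect n J i =
      c.rest n J i * (c.pairFactor i (i + 2) * (c (i + 1)).single -
        c.pairFactor (i + 1) (i + 2) * (c i).single) := by
  rw [Code.defect_act h.notMem (swap_fixes (by omega) (by omega) (by omega))
    (swap_mid_right i) (Equiv.swap_apply_right _ _) (Equiv.swap_apply_left _ _),
    c.pairFactor_comm (i + 2)]

theorem defect_swap_left_right (h : Exchangeable Δ g n i J) (c : Code) :
    (c.act (Equiv.swap i (i + 2))).defect n J i = -c.defect n J i := by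
  rw [Code.defect_act h.notMem (swap_fixes (by omega) (by omega) (by omega))
    (Equiv.swap_apply_right _ _) (swap_left_right i) (Equiv.swap_apply_left _ _),
    c.pairFactor_comm (i + 2), c.pairFactor_comm (i + 1) i, Code.defect]
  ring

/-- Moving the third element to the first position. -/
theorem defect_rotate_right (h : Exchangeable Δ g n i J) (c : Code) :
    ((c.act (Equiv.swap (i + 1) (i + 2))).act (Equiv.swap i (i + 1))).defect n J i =
      c.rest n J i * (c.pairFactor i (i + 2) * (c (i + 1)).single -
        c.pairFactor i (i + 1) * (c (i + 2)).single) := by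
  set σ := Equiv.swap (i + 1) (i + 2) with hσ
  have h1 : σ i = i := swap_mid_right i
  have h2 : σ (i + 2) = i + 1 := Equiv.swap_apply_right _ _
  have h3 : σ (i + 1) = i + 2 := Equiv.swap_apply_left _ _
  have e1 := Code.pairFactor_act σ c i (i + 2)
  have e2 := Code.pairFactor_act σ c i (i + 1)
  have e3 := Code.act_apply σ c (i + 1)
  have e4 := Code.act_apply σ c (i + 2)
  rw [h1, h2] at e1
  rw [h1, h3] at e2
  rw [h3] at e3
  rw [h2] at e4
  rw [h.defect_swap_left_mid, e1, e2, e3, e4, Label.single_relabel, Label.single_relabel,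
    Code.rest_act h.notMem σ (swap_fixes (by omega) (by omega) (by omega))]

/-- Moving the first element to the third position. -/
theorem defect_rotate_left (h : Exchangeable Δ g n i J) (c : Code) :
    ((c.act (Equiv.swap i (i + 1))).act (Equiv.swap (i + 1) (i + 2))).defect n J i =
      c.rest n J i * (c.pairFactor (i + 1) (i + 2) * (c i).single -
        c.pairFactor i (i + 2) * (c (i + 1)).single) := by
  set σ := Equiv.swap i (i + 1) with hσ
  have h1 : σ i = i + 1 := Equiv.swap_apply_left _ _
  have h2 : σ (i + 2) = i + 2 := swap_left_mid i
  have h3 : σ (i + 1) = i := Equiv.swap_apply_right _ _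
  have e1 := Code.pairFactor_act σ c i (i + 2)
  have e2 := Code.pairFactor_act σ c (i + 1) (i + 2)
  have e3 := Code.act_apply σ c (i + 1)
  have e4 := Code.act_apply σ c i
  rw [h1, h2] at e1
  rw [h3, h2] at e2
  rw [h3] at e3
  rw [h1] at e4
  rw [h.defect_swap_mid_right, e1, e2, e3, e4, Label.single_relabel, Label.single_relabel,
    Code.rest_act h.notMem σ (swap_fixes (by omega) (by omega) (by omega))]

/-! ### Three elements without adjacencies -/

theorem sum_defect_of_no_step (h : Exchangeable Δ g n i J) :
    ∑ c ∈ (codeFinset Δ g).filter (fun c => ¬ c.Step i (i + 1) ∧ ¬ c.Step i (i + 2) ∧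
      ¬ c.Step (i + 1) (i + 2)), c.defect n J i = 0 := by
  have key : ∀ c ∈ codeFinset Δ g, (¬ c.Step i (i + 1) ∧ ¬ c.Step i (i + 2) ∧
      ¬ c.Step (i + 1) (i + 2)) → c.act (Equiv.swap i (i + 2)) ∈ codeFinset Δ g ∧
      (¬ (c.act (Equiv.swap i (i + 2))).Step i (i + 1) ∧
      ¬ (c.act (Equiv.swap i (i + 2))).Step i (i + 2) ∧
      ¬ (c.act (Equiv.swap i (i + 2))).Step (i + 1) (i + 2)) := by
    rintro c hc ⟨h1, h2, h3⟩
    refine ⟨h.swap_left_right_mem hc h1 h2 h3, ?_⟩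
    simp only [Code.step_act_iff, Equiv.symm_swap, Equiv.swap_apply_left, Equiv.swap_apply_right,
      swap_left_right]
    exact ⟨not_step_of_lt hc (by omega), not_step_of_lt hc (by omega), not_step_of_lt hc (by omega)⟩
  refine sum_filter_eq_zero (Equiv.swap_apply_self _ _) key fun c _ _ => ?_
  rw [h.defect_swap_left_right]
  ring

/-! ### A vertex with two adjacent edges on the same side -/

/-- The labels force two edges, of weights `a` and `b`, entering the vertex at `i + 2`. Exchanging
them is allowed, and the two defects add up to `2 * edgePair a b - [b]²[a]₂ - [a]²[b]₂` times
`rest`, which is zero. -/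
theorem sum_defect_of_enter_enter (h : Exchangeable Δ g n i J) :
    ∑ c ∈ (codeFinset Δ g).filter (fun c => ¬ c.Step i (i + 1) ∧ c.Step i (i + 2) ∧
      c.Step (i + 1) (i + 2)), c.defect n J i = 0 := by
  have key : ∀ c ∈ codeFinset Δ g, (¬ c.Step i (i + 1) ∧ c.Step i (i + 2) ∧
      c.Step (i + 1) (i + 2)) → c.act (Equiv.swap i (i + 1)) ∈ codeFinset Δ g ∧
      (¬ (c.act (Equiv.swap i (i + 1))).Step i (i + 1) ∧
      (c.act (Equiv.swap i (i + 1))).Step i (i + 2) ∧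
      (c.act (Equiv.swap i (i + 1))).Step (i + 1) (i + 2)) := by
    rintro c hc ⟨h1, h2, h3⟩
    refine ⟨h.swap_left_mid_mem hc h1, ?_⟩
    simp only [Code.step_act_iff, Equiv.symm_swap, Equiv.swap_apply_left, Equiv.swap_apply_right,
      swap_left_mid]
    exact ⟨not_step_of_lt hc (by omega), h3, h2⟩
  refine sum_filter_eq_zero (Equiv.swap_apply_self _ _) key ?_
  rintro c hc ⟨h1, h2, h3⟩
  have hwf := wf_of_mem_codeFinset hc
  rw [h.defect_swap_left_mid, Code.defect, Code.pairFactor_of_step h2, Code.pairFactor_of_step h3,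
    hwf.pairFactor_of_not_step (by omega) h1]
  rcases h2 with ⟨s, a, h2⟩ | ⟨t, a, h2⟩ <;> rcases h3 with ⟨s', b, h3⟩ | ⟨t', b, h3⟩
  · obtain ⟨-, l, r, hv⟩ := hwf.lt_tgt h2
    rw [h2, h3, hv]
    simp only [Label.share, Label.single, Label.paired, ne_eq, reduceCtorEq, not_false_eq_true,
      and_self, or_true, if_true]
    linear_combination (c.rest n J i) * two_mul_edgePair a b
  · obtain ⟨-, l, r, hv⟩ := hwf.lt_tgt h2
    simp [h3] at hv
  · obtain ⟨-, l, r, hv⟩ := hwf.lt_tgt h3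
    simp [h2] at hv
  · rw [h2] at h3
    simp at h3

theorem sum_defect_of_leave_leave (h : Exchangeable Δ g n i J) :
    ∑ c ∈ (codeFinset Δ g).filter (fun c => c.Step i (i + 1) ∧ c.Step i (i + 2) ∧
      ¬ c.Step (i + 1) (i + 2)), c.defect n J i = 0 := by
  have key : ∀ c ∈ codeFinset Δ g, (c.Step i (i + 1) ∧ c.Step i (i + 2) ∧
      ¬ c.Step (i + 1) (i + 2)) → c.act (Equiv.swap (i + 1) (i + 2)) ∈ codeFinset Δ g ∧
      ((c.act (Equiv.swap (i + 1) (i + 2))).Step i (i + 1) ∧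
      (c.act (Equiv.swap (i + 1) (i + 2))).Step i (i + 2) ∧
      ¬ (c.act (Equiv.swap (i + 1) (i + 2))).Step (i + 1) (i + 2)) := by
    rintro c hc ⟨h1, h2, h3⟩
    refine ⟨h.swap_mid_right_mem hc h3, ?_⟩
    simp only [Code.step_act_iff, Equiv.symm_swap, Equiv.swap_apply_left, Equiv.swap_apply_right,
      swap_mid_right]
    exact ⟨h2, h1, not_step_of_lt hc (by omega)⟩
  refine sum_filter_eq_zero (Equiv.swap_apply_self _ _) key ?_
  rintro c hc ⟨h1, h2, h3⟩
  have hwf := wf_of_mem_codeFinset hc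
  rw [h.defect_swap_mid_right, Code.defect, Code.pairFactor_of_step h2, Code.pairFactor_of_step h1,
    hwf.pairFactor_of_not_step (by omega) h3]
  rcases h1 with ⟨s, a, h1⟩ | ⟨t, a, h1⟩ <;> rcases h2 with ⟨s', b, h2⟩ | ⟨t', b, h2⟩
  · rw [h1] at h2
    simp at h2
  · obtain ⟨-, l, r, hv⟩ := hwf.src_lt h2
    simp [h1] at hv
  · obtain ⟨-, l, r, hv⟩ := hwf.src_lt h1
    simp [h2] at hv
  · obtain ⟨-, l, r, hv⟩ := hwf.src_lt h1
    rw [h1, h2, hv]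
    simp only [Label.share, Label.single, Label.paired, ne_eq, reduceCtorEq, not_false_eq_true,
      and_self, true_or, if_true]
    linear_combination -(c.rest n J i) * two_mul_edgePair a b

/-! ### A single adjacency -/

/-- Let `e` enter `v`, with `x` adjacent to neither. The orders `e v x`, `e x v`, `x e v` are all
allowed and are parametrized by the first. In the sum of their defects the factor of `{e, v}` occurs
with both signs, that of `{v, x}` is zero, and that of `{e, x}` occurs twice. -/
theorem sum_defect_of_single_enters (h : Exchangeable Δ g n i J) :
    ∑ c ∈ (codeFinset Δ g).filter (fun c => (c.Step i (i + 1) ∧ c.Enters i (i + 1)) ∧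
        ¬ c.Step i (i + 2) ∧ ¬ c.Step (i + 1) (i + 2)), c.defect n J i +
      ∑ c ∈ (codeFinset Δ g).filter (fun c => ¬ c.Step i (i + 1) ∧
        (c.Step i (i + 2) ∧ c.Enters i (i + 2)) ∧ ¬ c.Step (i + 1) (i + 2)), c.defect n J i +
      ∑ c ∈ (codeFinset Δ g).filter (fun c => ¬ c.Step i (i + 1) ∧ ¬ c.Step i (i + 2) ∧
        (c.Step (i + 1) (i + 2) ∧ c.Enters (i + 1) (i + 2))), c.defect n J i =
    ∑ c ∈ (codeFinset Δ g).filter (fun c => (c.Step i (i + 1) ∧ c.Enters i (i + 1)) ∧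
        ¬ c.Step i (i + 2) ∧ ¬ c.Step (i + 1) (i + 2)),
      2 * c.rest n J i * (c i).share (c (i + 2)) := by
  rw [sum_filter_act (σ := Equiv.swap i (i + 1)) (Equiv.swap_apply_self _ _)
    (P := fun c => ¬ c.Step i (i + 1) ∧
        (c.Step i (i + 2) ∧ c.Enters i (i + 2)) ∧ ¬ c.Step (i + 1) (i + 2))
    (Q := fun c => ¬ c.Step i (i + 1) ∧ ¬ c.Step i (i + 2) ∧
        (c.Step (i + 1) (i + 2) ∧ c.Enters (i + 1) (i + 2))),
    sum_filter_act (σ := Equiv.swap (i + 1) (i + 2)) (Equiv.swap_apply_self _ _)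
    (P := fun c => (c.Step i (i + 1) ∧ c.Enters i (i + 1)) ∧
        ¬ c.Step i (i + 2) ∧ ¬ c.Step (i + 1) (i + 2))
    (Q := fun c => ¬ c.Step i (i + 1) ∧
        (c.Step i (i + 2) ∧ c.Enters i (i + 2)) ∧ ¬ c.Step (i + 1) (i + 2)),
    sum_filter_act (σ := Equiv.swap (i + 1) (i + 2)) (Equiv.swap_apply_self _ _)
    (P := fun c => (c.Step i (i + 1) ∧ c.Enters i (i + 1)) ∧
        ¬ c.Step i (i + 2) ∧ ¬ c.Step (i + 1) (i + 2))
    (Q := fun c => ¬ c.Step i (i + 1) ∧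
        (c.Step i (i + 2) ∧ c.Enters i (i + 2)) ∧ ¬ c.Step (i + 1) (i + 2)),
    ← Finset.sum_add_distrib, ← Finset.sum_add_distrib]
  · refine Finset.sum_congr rfl fun c hc => ?_
    obtain ⟨hc, ⟨h1, s, a, h1'⟩, h2, h3⟩ := Finset.mem_filter.1 hc
    have hwf := wf_of_mem_codeFinset hc
    obtain ⟨-, l, r, hv⟩ := hwf.lt_tgt h1'
    rw [h.defect_rotate_right, h.defect_swap_mid_right, Code.defect,
      hwf.pairFactor_of_not_step (by omega) h2, hwf.pairFactor_of_not_step (by omega) h3, hv]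
    simp only [Label.share, Label.single]
    ring
  all_goals
    intro c hc h'
    simp only [Code.step_act_iff, Code.enters_act_iff, Equiv.symm_swap, Equiv.swap_apply_left,
      Equiv.swap_apply_right, swap_mid_right, swap_left_mid]
  · exact ⟨h.swap_mid_right_mem hc h'.2.2, h'.2.1, h'.1, not_step_of_lt hc (by omega)⟩
  · exact ⟨h.swap_mid_right_mem hc h'.2.2, h'.2.1, h'.1, not_step_of_lt hc (by omega)⟩
  · exact ⟨h.swap_mid_right_mem hc h'.2.2, h'.2.1, h'.1, not_step_of_lt hc (by omega)⟩
  · exact ⟨h.swap_mid_right_mem hc h'.2.2, h'.2.1, h'.1, not_step_of_lt hc (by omega)⟩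
  · exact ⟨h.swap_left_mid_mem hc h'.1, not_step_of_lt hc (by omega), h'.2.2, h'.2.1⟩
  · exact ⟨h.swap_left_mid_mem hc h'.1, not_step_of_lt hc (by omega), h'.2.2, h'.2.1⟩

/-- The mirror image, for `e` leaving `v`: the orders are `v e x`, `v x e`, `x v e`, parametrized by
the last. Reversing the order accounts for the sign. -/
theorem sum_defect_of_single_leaves (h : Exchangeable Δ g n i J) :
    ∑ c ∈ (codeFinset Δ g).filter (fun c => (c.Step i (i + 1) ∧ ¬ c.Enters i (i + 1)) ∧
        ¬ c.Step i (i + 2) ∧ ¬ c.Step (i + 1) (i + 2)), c.defect n J i +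
      ∑ c ∈ (codeFinset Δ g).filter (fun c => ¬ c.Step i (i + 1) ∧
        (c.Step i (i + 2) ∧ ¬ c.Enters i (i + 2)) ∧ ¬ c.Step (i + 1) (i + 2)), c.defect n J i +
      ∑ c ∈ (codeFinset Δ g).filter (fun c => ¬ c.Step i (i + 1) ∧ ¬ c.Step i (i + 2) ∧
        (c.Step (i + 1) (i + 2) ∧ ¬ c.Enters (i + 1) (i + 2))), c.defect n J i =
    -∑ c ∈ (codeFinset Δ g).filter (fun c => ¬ c.Step i (i + 1) ∧ ¬ c.Step i (i + 2) ∧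
        (c.Step (i + 1) (i + 2) ∧ ¬ c.Enters (i + 1) (i + 2))),
      2 * c.rest n J i * (c i).share (c (i + 2)) := by
  rw [sum_filter_act (σ := Equiv.swap (i + 1) (i + 2)) (Equiv.swap_apply_self _ _)
    (P := fun c => ¬ c.Step i (i + 1) ∧
        (c.Step i (i + 2) ∧ ¬ c.Enters i (i + 2)) ∧ ¬ c.Step (i + 1) (i + 2))
    (Q := fun c => (c.Step i (i + 1) ∧ ¬ c.Enters i (i + 1)) ∧
        ¬ c.Step i (i + 2) ∧ ¬ c.Step (i + 1) (i + 2)),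
    sum_filter_act (σ := Equiv.swap i (i + 1)) (Equiv.swap_apply_self _ _)
    (P := fun c => ¬ c.Step i (i + 1) ∧ ¬ c.Step i (i + 2) ∧
        (c.Step (i + 1) (i + 2) ∧ ¬ c.Enters (i + 1) (i + 2)))
    (Q := fun c => ¬ c.Step i (i + 1) ∧
        (c.Step i (i + 2) ∧ ¬ c.Enters i (i + 2)) ∧ ¬ c.Step (i + 1) (i + 2)),
    sum_filter_act (σ := Equiv.swap i (i + 1)) (Equiv.swap_apply_self _ _)
    (P := fun c => ¬ c.Step i (i + 1) ∧ ¬ c.Step i (i + 2) ∧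
        (c.Step (i + 1) (i + 2) ∧ ¬ c.Enters (i + 1) (i + 2)))
    (Q := fun c => ¬ c.Step i (i + 1) ∧
        (c.Step i (i + 2) ∧ ¬ c.Enters i (i + 2)) ∧ ¬ c.Step (i + 1) (i + 2)),
    ← Finset.sum_add_distrib, ← Finset.sum_add_distrib, ← Finset.sum_neg_distrib]
  · refine Finset.sum_congr rfl fun c hc => ?_
    obtain ⟨hc, h1, h2, h3, h3'⟩ := Finset.mem_filter.1 hc
    have hwf := wf_of_mem_codeFinset hc
    obtain ⟨t, b, h3''⟩ := h3.resolve_left h3'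
    obtain ⟨-, l, r, hv⟩ := hwf.src_lt h3''
    rw [h.defect_rotate_left, h.defect_swap_left_mid, Code.defect,
      hwf.pairFactor_of_not_step (by omega) h1, hwf.pairFactor_of_not_step (by omega) h2,
      Label.share_comm (c i) (c (i + 1)), hv]
    simp only [Label.share, Label.single]
    ring
  all_goals
    intro c hc h'
    simp only [Code.step_act_iff, Code.enters_act_iff, Equiv.symm_swap, Equiv.swap_apply_left,
      Equiv.swap_apply_right, swap_mid_right, swap_left_mid]
  · exact ⟨h.swap_left_mid_mem hc h'.1, not_step_of_lt hc (by omega), h'.2.2, h'.2.1⟩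
  · exact ⟨h.swap_left_mid_mem hc h'.1, not_step_of_lt hc (by omega), h'.2.2, h'.2.1⟩
  · exact ⟨h.swap_left_mid_mem hc h'.1, not_step_of_lt hc (by omega), h'.2.2, h'.2.1⟩
  · exact ⟨h.swap_left_mid_mem hc h'.1, not_step_of_lt hc (by omega), h'.2.2, h'.2.1⟩
  · exact ⟨h.swap_mid_right_mem hc h'.2.2, h'.2.1, h'.1, not_step_of_lt hc (by omega)⟩
  · exact ⟨h.swap_mid_right_mem hc h'.2.2, h'.2.1, h'.1, not_step_of_lt hc (by omega)⟩

end Exchangeable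

/-! ### An edge entering and an edge leaving a vertex -/

namespace Code

/-- An edge of weight `a` enters the vertex at `i + 1`, an edge of weight `b < a` leaves it. -/
def Narrowing (i : ℕ) (c : Code) : Prop :=
  ∃ s t a b, c i = .edge s (some (i + 1)) a ∧ c (i + 2) = .edge (some (i + 1)) t b ∧ b < a

/-- An edge of weight `a` enters the vertex at `i + 1`, an edge of weight `b > a` leaves it. -/
def Widening (i : ℕ) (c : Code) : Prop :=
  ∃ s t a b, c i = .edge s (some (i + 1)) a ∧ c (i + 2) = .edge (some (i + 1)) t b ∧ a < b

/-- An edge enters the vertex at `i + 1`, another edge leaves the same vertex as the first. -/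
def Branching (i : ℕ) (c : Code) : Prop :=
  ∃ u t a b, c i = .edge (some u) (some (i + 1)) a ∧ c (i + 2) = .edge (some u) t b

/-- An edge leaves the vertex at `i + 1`, another edge enters the same vertex as the first. -/
def Merging (i : ℕ) (c : Code) : Prop :=
  ∃ s u a b, c i = .edge s (some u) a ∧ c (i + 2) = .edge (some (i + 1)) (some u) b

/-- Replacing the labels at `i` and `i + 2`. -/
def replace (i : ℕ) (x y : Label) (c : Code) : Code :=
  Function.update (Function.update c i x) (i + 2) y

theorem replace_left (i : ℕ) (x y : Label) (c : Code) : c.replace i x y i = x := by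
  rw [replace, Function.update_of_ne (by omega), Function.update_self]

theorem replace_right (i : ℕ) (x y : Label) (c : Code) : c.replace i x y (i + 2) = y :=
  Function.update_self ..

theorem replace_of_ne {i k : ℕ} (x y : Label) (c : Code) (h : k ≠ i) (h' : k ≠ i + 2) :
    c.replace i x y k = c k := by
  rw [replace, Function.update_of_ne h', Function.update_of_ne h]

theorem replace_replace {i : ℕ} {x y x' y' : Label} {c : Code} (hx : c i = x') (hy : c (i + 2) = y') :
    (c.replace i x y).replace i x' y' = c := by
  funext k
  by_cases h : k = i
  · subst h
    rw [replace_left, hx]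
  by_cases h' : k = i + 2
  · subst h'
    rw [replace_right, hy]
  · rw [replace_of_ne _ _ _ h h', replace_of_ne _ _ _ h h']

/-- Sliding the origin of the edge at `i + 2` backwards along the edge at `i`. -/
def slideSrc (i : ℕ) (c : Code) : Code :=
  match c i, c (i + 2) with
  | .edge s t a, .edge _ t' b => c.replace i (.edge s t (a - b)) (.edge s t' b)
  | _, _ => c

/-- Sliding the origin of the edge at `i + 2` forwards along the edge at `i`. -/
def unslideSrc (i : ℕ) (c : Code) : Code :=
  match c i, c (i + 2) with
  | .edge s t a, .edge _ t' b => c.replace i (.edge s t (a + b)) (.edge t t' b)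
  | _, _ => c

/-- Sliding the end of the edge at `i` forwards along the edge at `i + 2`. -/
def slideTgt (i : ℕ) (c : Code) : Code :=
  match c i, c (i + 2) with
  | .edge s _ a, .edge s' t b => c.replace i (.edge s t a) (.edge s' t (b - a))
  | _, _ => c

/-- Sliding the end of the edge at `i` backwards along the edge at `i + 2`. -/
def unslideTgt (i : ℕ) (c : Code) : Code :=
  match c i, c (i + 2) with
  | .edge s _ a, .edge s' t b => c.replace i (.edge s s' a) (.edge s' t (b + a))
  | _, _ => c

theorem slideSrc_eq {i : ℕ} {c : Code} {s t s' t' : Option ℕ} {a b : ℕ} (h1 : c i = .edge s t a)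
    (h2 : c (i + 2) = .edge s' t' b) :
    c.slideSrc i = c.replace i (.edge s t (a - b)) (.edge s t' b) := by
  simp only [slideSrc, h1, h2]

theorem unslideSrc_eq {i : ℕ} {c : Code} {s t s' t' : Option ℕ} {a b : ℕ} (h1 : c i = .edge s t a)
    (h2 : c (i + 2) = .edge s' t' b) :
    c.unslideSrc i = c.replace i (.edge s t (a + b)) (.edge t t' b) := by
  simp only [unslideSrc, h1, h2]

theorem slideTgt_eq {i : ℕ} {c : Code} {s t s' t' : Option ℕ} {a b : ℕ} (h1 : c i = .edge s t a)
    (h2 : c (i + 2) = .edge s' t' b) :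
    c.slideTgt i = c.replace i (.edge s t' a) (.edge s' t' (b - a)) := by
  simp only [slideTgt, h1, h2]

theorem unslideTgt_eq {i : ℕ} {c : Code} {s t s' t' : Option ℕ} {a b : ℕ} (h1 : c i = .edge s t a)
    (h2 : c (i + 2) = .edge s' t' b) :
    c.unslideTgt i = c.replace i (.edge s s' a) (.edge s' t' (b + a)) := by
  simp only [unslideTgt, h1, h2]

end Code

/-! ### Cancellation by sliding edges -/

namespace Exchangeable

variable {Δ : Set (ℝ × ℝ)} {g n : ℕ} {i : ℕ} {J : Finset ℕ}

theorem rest_replace (h : Exchangeable Δ g n i J) (x y : Label) (c : Code) :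
    (c.replace i x y).rest n J i = c.rest n J i :=
  Code.rest_congr h.notMem fun _ h1 _ h3 => Code.replace_of_ne _ _ _ h1 h3

theorem defect_of_through {c : Code} (hc : c ∈ codeFinset Δ g)
    {s t : Option ℕ} {a b : ℕ} (h1 : c i = .edge s (some (i + 1)) a)
    (h2 : c (i + 2) = .edge (some (i + 1)) t b) :
    c.defect n J i = c.rest n J i *
      (quantum₂ a * quantum b ^ 2 - quantum₂ b * quantum a ^ 2) := by
  obtain ⟨-, l, r, hv⟩ := (wf_of_mem_codeFinset hc).lt_tgt h1
  rw [Code.defect, Code.pairFactor_of_step (Or.inl ⟨_, _, h1⟩),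
    Code.pairFactor_of_step (Or.inr ⟨_, _, h2⟩), h1, h2, hv]
  simp only [Label.paired, Label.single, mul_one, one_mul]

/-- Sliding backwards replaces weights `a`, `b` by `a - b`, `b`, with both edges now leaving the
same vertex. `slideSrc` and `unslideSrc` are inverse bijections between narrowing and branching
codes. -/
theorem sum_defect_narrowing (h : Exchangeable Δ g n i J) :
    ∑ c ∈ (codeFinset Δ g).filter (Code.Narrowing i), c.defect n J i =
      -∑ c ∈ (codeFinset Δ g).filter (Code.Branching i),
        2 * c.rest n J i * (c i).share (c (i + 2)) := by
  rw [← Finset.sum_neg_distrib]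
  refine Finset.sum_nbij' (Code.slideSrc i) (Code.unslideSrc i) ?_ ?_ ?_ ?_ ?_
  · intro c hc
    obtain ⟨hc, s, t, a, b, h1, h2, hab⟩ := Finset.mem_filter.1 hc
    have hb := (wf_of_mem_codeFinset hc).w_pos h2
    -- Since `1 ≤ b < a`, the incoming edge has weight at least `2`, so it is bounded and has an
    -- origin to slide to.
    obtain ⟨u, rfl⟩ := Option.ne_none_iff_exists'.1 (show s ≠ none by
      rintro rfl
      have := (wf_of_mem_codeFinset hc).w_infinite h1 (Or.inl rfl)
      omega)
    rw [Code.slideSrc_eq h1 h2, Finset.mem_filter]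
    refine ⟨mem_codeFinset.2 ?_, u, t, a - b, b, Code.replace_left .., Code.replace_right ..⟩
    exact slide_src_mem_codes (mem_codeFinset.1 hc) h1 h2 (by omega) (by omega) (by omega)
      (Or.inr ⟨rfl, rfl, by omega⟩)
  · intro c hc
    obtain ⟨hc, u, t, a, b, h1, h2⟩ := Finset.mem_filter.1 hc
    have ha := (wf_of_mem_codeFinset hc).w_pos h1
    rw [Code.unslideSrc_eq h1 h2, Finset.mem_filter]
    refine ⟨mem_codeFinset.2 ?_, some u, t, a + b, b, Code.replace_left .., Code.replace_right ..,
      by omega⟩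
    exact slide_src_mem_codes (mem_codeFinset.1 hc) h1 h2 (by omega) (by omega) (by omega)
      (Or.inl ⟨rfl, rfl, by omega⟩)
  · intro c hc
    obtain ⟨hc, s, t, a, b, h1, h2, hab⟩ := Finset.mem_filter.1 hc
    rw [Code.slideSrc_eq h1 h2, Code.unslideSrc_eq (Code.replace_left ..) (Code.replace_right ..),
      Nat.sub_add_cancel hab.le]
    exact Code.replace_replace h1 h2
  · intro c hc
    obtain ⟨hc, u, t, a, b, h1, h2⟩ := Finset.mem_filter.1 hc
    rw [Code.unslideSrc_eq h1 h2, Code.slideSrc_eq (Code.replace_left ..) (Code.replace_right ..),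
      Nat.add_sub_cancel]
    exact Code.replace_replace h1 h2
  · intro c hc
    obtain ⟨hc, s, t, a, b, h1, h2, hab⟩ := Finset.mem_filter.1 hc
    have hb := (wf_of_mem_codeFinset hc).w_pos h2
    have hs : s ≠ none := by
      rintro rfl
      have := (wf_of_mem_codeFinset hc).w_infinite h1 (Or.inl rfl)
      omega
    have key := two_mul_edgePair_add (a - b) b
    rw [Nat.sub_add_cancel hab.le] at key
    rw [Code.slideSrc_eq h1 h2, h.rest_replace, Code.replace_left, Code.replace_right,
      defect_of_through hc h1 h2]
    simp only [Label.share, hs, ne_eq, not_false_eq_true, and_self, true_or, if_true]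
    linear_combination (c.rest n J i) * key

theorem sum_defect_widening (h : Exchangeable Δ g n i J) :
    ∑ c ∈ (codeFinset Δ g).filter (Code.Widening i), c.defect n J i =
      ∑ c ∈ (codeFinset Δ g).filter (Code.Merging i),
        2 * c.rest n J i * (c i).share (c (i + 2)) := by
  refine Finset.sum_nbij' (Code.slideTgt i) (Code.unslideTgt i) ?_ ?_ ?_ ?_ ?_
  · intro c hc
    obtain ⟨hc, s, t, a, b, h1, h2, hab⟩ := Finset.mem_filter.1 hc
    have ha := (wf_of_mem_codeFinset hc).w_pos h1
    obtain ⟨u, rfl⟩ := Option.ne_none_iff_exists'.1 (show t ≠ none by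
      rintro rfl
      have := (wf_of_mem_codeFinset hc).w_infinite h2 (Or.inr rfl)
      omega)
    rw [Code.slideTgt_eq h1 h2, Finset.mem_filter]
    refine ⟨mem_codeFinset.2 ?_, s, u, a, b - a, Code.replace_left .., Code.replace_right ..⟩
    exact slide_tgt_mem_codes (mem_codeFinset.1 hc) h1 h2 (by omega) (by omega) (by omega)
      (Or.inr ⟨rfl, rfl, by omega⟩)
  · intro c hc
    obtain ⟨hc, s, u, a, b, h1, h2⟩ := Finset.mem_filter.1 hc
    have hb := (wf_of_mem_codeFinset hc).w_pos h2
    rw [Code.unslideTgt_eq h1 h2, Finset.mem_filter]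
    refine ⟨mem_codeFinset.2 ?_, s, some u, a, b + a, Code.replace_left .., Code.replace_right ..,
      by omega⟩
    exact slide_tgt_mem_codes (mem_codeFinset.1 hc) h1 h2 (by omega) (by omega) (by omega)
      (Or.inl ⟨rfl, rfl, by omega⟩)
  · intro c hc
    obtain ⟨hc, s, t, a, b, h1, h2, hab⟩ := Finset.mem_filter.1 hc
    rw [Code.slideTgt_eq h1 h2, Code.unslideTgt_eq (Code.replace_left ..) (Code.replace_right ..),
      Nat.sub_add_cancel hab.le]
    exact Code.replace_replace h1 h2
  · intro c hc
    obtain ⟨hc, s, u, a, b, h1, h2⟩ := Finset.mem_filter.1 hc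
    rw [Code.unslideTgt_eq h1 h2, Code.slideTgt_eq (Code.replace_left ..) (Code.replace_right ..),
      Nat.add_sub_cancel]
    exact Code.replace_replace h1 h2
  · intro c hc
    obtain ⟨hc, s, t, a, b, h1, h2, hab⟩ := Finset.mem_filter.1 hc
    have ha := (wf_of_mem_codeFinset hc).w_pos h1
    have ht : t ≠ none := by
      rintro rfl
      have := (wf_of_mem_codeFinset hc).w_infinite h2 (Or.inr rfl)
      omega
    have key := two_mul_edgePair_add (b - a) a
    -- Here the edge at `i` keeps weight `a` and the one at `i + 2` gets `b - a`, the opposite order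
    -- of arguments to `key`.
    rw [Nat.sub_add_cancel hab.le, edgePair_comm] at key
    rw [Code.slideTgt_eq h1 h2, h.rest_replace, Code.replace_left, Code.replace_right,
      defect_of_through hc h1 h2]
    simp only [Label.share, ht, ne_eq, not_false_eq_true, and_self, or_true, if_true]
    linear_combination -(c.rest n J i) * key

/-- Besides these two families, the pattern allows two edges of equal weight around a vertex, and an
edge between two vertices; the defect is zero in both. -/
theorem sum_defect_of_through :
    ∑ c ∈ (codeFinset Δ g).filter (fun c => c.Step i (i + 1) ∧ ¬ c.Step i (i + 2) ∧
        c.Step (i + 1) (i + 2)), c.defect n J i =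
      ∑ c ∈ (codeFinset Δ g).filter (Code.Narrowing i), c.defect n J i +
        ∑ c ∈ (codeFinset Δ g).filter (Code.Widening i), c.defect n J i := by
  rw [Finset.sum_filter, Finset.sum_filter, Finset.sum_filter, ← Finset.sum_add_distrib]
  refine Finset.sum_congr rfl fun c hc => ?_
  have hwf := wf_of_mem_codeFinset hc
  have hstep : ∀ {s t a b}, c i = .edge s (some (i + 1)) a → c (i + 2) = .edge (some (i + 1)) t b →
      c.Step i (i + 1) ∧ ¬ c.Step i (i + 2) ∧ c.Step (i + 1) (i + 2) := by
    intro s t a b h1 h2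
    refine ⟨Or.inl ⟨_, _, h1⟩, ?_, Or.inr ⟨_, _, h2⟩⟩
    rintro (⟨_, _, h3⟩ | ⟨_, _, h3⟩)
    · rw [h1] at h3
      simp at h3
    · rw [h2] at h3
      simp at h3
  by_cases hmid : c.Step i (i + 1) ∧ ¬ c.Step i (i + 2) ∧ c.Step (i + 1) (i + 2)
  · rw [if_pos hmid]
    obtain ⟨h12, -, h23⟩ := hmid
    rcases h12 with ⟨s, a, h1⟩ | ⟨t, a, h1⟩
    · obtain ⟨-, l, r, hv⟩ := hwf.lt_tgt h1
      rcases h23 with ⟨s', b, h2⟩ | ⟨t', b, h2⟩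
      · simp [h2] at hv
      have hN : Code.Narrowing i c ↔ b < a := by simp [Code.Narrowing, h1, h2]
      have hW : Code.Widening i c ↔ a < b := by simp [Code.Widening, h1, h2]
      simp only [hN, hW]
      rcases lt_trichotomy a b with hab | rfl | hab
      · rw [if_neg hab.not_gt, if_pos hab, zero_add]
      · rw [defect_of_through hc h1 h2]
        simp
      · rw [if_neg hab.not_gt, if_pos hab, add_zero]
    · obtain ⟨-, l, r, hv⟩ := hwf.src_lt h1
      rcases h23 with ⟨s', b, h2⟩ | ⟨t', b, h2⟩
      swap
      · obtain ⟨-, l', r', hv'⟩ := hwf.src_lt h2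
        simp [h1] at hv'
      obtain ⟨-, l', r', hv'⟩ := hwf.lt_tgt h2
      have hN : ¬ Code.Narrowing i c := by simp [Code.Narrowing, hv]
      have hW : ¬ Code.Widening i c := by simp [Code.Widening, hv]
      rw [if_neg hN, if_neg hW, Code.defect, Code.pairFactor_of_step (Or.inr ⟨_, _, h1⟩),
        Code.pairFactor_of_step (Or.inl ⟨_, _, h2⟩), hv, hv']
      simp only [Label.paired, Label.single]
      ring
  · have hN : ¬ Code.Narrowing i c := by
      rintro ⟨s, t, a, b, h1, h2, -⟩
      exact hmid (hstep h1 h2)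
    have hW : ¬ Code.Widening i c := by
      rintro ⟨s, t, a, b, h1, h2, -⟩
      exact hmid (hstep h1 h2)
    rw [if_neg hmid, if_neg hN, if_neg hW, add_zero]

/-- Codes that are not branching contribute zero: sharing the target would make the edge at `i + 2`
enter the vertex at `i + 1`, which comes before it, so a nonzero factor requires a common origin. -/
theorem sum_share_enters :
    ∑ c ∈ (codeFinset Δ g).filter (fun c => (c.Step i (i + 1) ∧ c.Enters i (i + 1)) ∧
        ¬ c.Step i (i + 2) ∧ ¬ c.Step (i + 1) (i + 2)),
      2 * c.rest n J i * (c i).share (c (i + 2)) =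
    ∑ c ∈ (codeFinset Δ g).filter (Code.Branching i),
      2 * c.rest n J i * (c i).share (c (i + 2)) := by
  symm
  apply Finset.sum_subset
  · intro c hc
    obtain ⟨hc, u, t, a, b, h1, h2⟩ := Finset.mem_filter.1 hc
    have hwf := wf_of_mem_codeFinset hc
    obtain ⟨-, l, r, hv⟩ := hwf.lt_tgt h1
    have hu := (hwf.src_lt h1).1
    refine Finset.mem_filter.2 ⟨hc, ⟨Or.inl ⟨_, _, h1⟩, ⟨_, _, h1⟩⟩, ?_, ?_⟩
    · rintro (⟨_, _, h3⟩ | ⟨_, _, h3⟩)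
      · simp [h1] at h3
      · simp only [h2, Label.edge.injEq, Option.some.injEq] at h3
        omega
    · rintro (⟨_, _, h3⟩ | ⟨_, _, h3⟩)
      · simp [hv] at h3
      · simp only [h2, Label.edge.injEq, Option.some.injEq] at h3
        omega
  · intro c hc hc'
    obtain ⟨hc, ⟨-, s, a, h1⟩, -, -⟩ := Finset.mem_filter.1 hc
    have hB : ¬ Code.Branching i c := fun hB => hc' (Finset.mem_filter.2 ⟨hc, hB⟩)
    rw [h1]
    cases h2 : c (i + 2) with
    | out => simp [Label.share]
    | vertex l r => simp [Label.share]
    | edge s' t b =>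
      rw [Label.share, if_neg, mul_zero]
      rintro (⟨rfl, hs⟩ | ⟨rfl, -⟩)
      · obtain ⟨u, rfl⟩ := Option.ne_none_iff_exists'.1 hs
        exact hB ⟨u, t, a, b, h1, h2⟩
      · have := ((wf_of_mem_codeFinset hc).lt_tgt h2).1
        omega

theorem sum_share_leaves :
    ∑ c ∈ (codeFinset Δ g).filter (fun c => ¬ c.Step i (i + 1) ∧ ¬ c.Step i (i + 2) ∧
        (c.Step (i + 1) (i + 2) ∧ ¬ c.Enters (i + 1) (i + 2))),
      2 * c.rest n J i * (c i).share (c (i + 2)) =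
    ∑ c ∈ (codeFinset Δ g).filter (Code.Merging i),
      2 * c.rest n J i * (c i).share (c (i + 2)) := by
  symm
  apply Finset.sum_subset
  · intro c hc
    obtain ⟨hc, s, u, a, b, h1, h2⟩ := Finset.mem_filter.1 hc
    have hwf := wf_of_mem_codeFinset hc
    obtain ⟨-, l, r, hv⟩ := hwf.src_lt h2
    have hu := (hwf.lt_tgt h2).1
    refine Finset.mem_filter.2 ⟨hc, ?_, ?_, Or.inr ⟨_, _, h2⟩, ?_⟩
    · rintro (⟨_, _, h3⟩ | ⟨_, _, h3⟩)
      · simp only [h1, Label.edge.injEq, Option.some.injEq] at h3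
        omega
      · simp [hv] at h3
    · rintro (⟨_, _, h3⟩ | ⟨_, _, h3⟩)
      · simp only [h1, Label.edge.injEq, Option.some.injEq] at h3
        omega
      · simp [h2] at h3
    · rintro ⟨_, _, h3⟩
      simp [hv] at h3
  · intro c hc hc'
    obtain ⟨hc, -, -, h3, h3'⟩ := Finset.mem_filter.1 hc
    obtain ⟨t, b, h2⟩ := h3.resolve_left h3'
    have hB : ¬ Code.Merging i c := fun hB => hc' (Finset.mem_filter.2 ⟨hc, hB⟩)
    rw [h2]
    cases h1 : c i with
    | out => simp [Label.share]
    | vertex l r => simp [Label.share]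
    | edge s t' a =>
      rw [Label.share, if_neg, mul_zero]
      rintro (⟨rfl, -⟩ | ⟨rfl, ht⟩)
      · have := ((wf_of_mem_codeFinset hc).src_lt h1).1
        omega
      · obtain ⟨u, rfl⟩ := Option.ne_none_iff_exists'.1 ht
        exact hB ⟨s, u, a, b, h1, h2⟩

/-! ### The exchange -/

/-- Steps join vertices to edges, so the adjacency is bipartite and has no triangle. -/
theorem not_three_steps {c : Code} (hc : c ∈ codeFinset Δ g) :
    ¬ (c.Step i (i + 1) ∧ c.Step i (i + 2) ∧ c.Step (i + 1) (i + 2)) := by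
  have hwf := wf_of_mem_codeFinset hc
  rintro ⟨h12, h13, h23⟩
  rcases h12 with ⟨s, a, h1⟩ | ⟨t, a, h1⟩ <;> rcases h13 with ⟨s', b, h2⟩ | ⟨t', b, h2⟩
  · simp [h1] at h2
  · obtain ⟨-, l, r, hv⟩ := hwf.src_lt h2
    simp [h1] at hv
  · obtain ⟨-, l, r, hv⟩ := hwf.src_lt h1
    simp [h2] at hv
  · rcases h23 with ⟨s'', d, h3⟩ | ⟨t'', d, h3⟩
    · obtain ⟨-, l, r, hv⟩ := hwf.lt_tgt h3
      simp [h2] at hv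
    · simp [h2] at h3

theorem sum_defect (h : Exchangeable Δ g n i J) : ∑ c ∈ codeFinset Δ g, c.defect n J i = 0 := by
  have h1 := h.sum_defect_of_no_step
  have h2 := h.sum_defect_of_enter_enter
  have h3 := h.sum_defect_of_leave_leave
  have h4 := sum_defect_of_through (Δ := Δ) (g := g) (n := n) (i := i) (J := J)
  have h5 := h.sum_defect_of_single_enters
  have h6 := h.sum_defect_of_single_leaves
  rw [sum_share_enters] at h5
  rw [sum_share_leaves] at h6
  rw [h.sum_defect_narrowing, h.sum_defect_widening] at h4
  -- On the right-hand side the branching terms of `h4` and `h5` cancel, and so do the merging terms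
  -- of `h4` and `h6`. It remains to see that the families on the left partition the codes.
  have key := congrArg₂ (· + ·) (congrArg₂ (· + ·) (congrArg₂ (· + ·) (congrArg₂ (· + ·)
    (congrArg₂ (· + ·) h1 h2) h3) h4) h5) h6
  refine Eq.trans ?_ (key.trans (by ring))
  clear key h1 h2 h3 h4 h5 h6
  simp only [Finset.sum_filter, ← Finset.sum_add_distrib]
  refine Finset.sum_congr rfl fun c hc => ?_
  have h123 := not_three_steps (i := i) hc
  by_cases s12 : c.Step i (i + 1)
  · by_cases s13 : c.Step i (i + 2)
    · have s23 : ¬ c.Step (i + 1) (i + 2) := fun s23 => h123 ⟨s12, s13, s23⟩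
      simp [s12, s13, s23]
    · by_cases s23 : c.Step (i + 1) (i + 2)
      · simp [s12, s13, s23]
      · by_cases e12 : c.Enters i (i + 1) <;> simp [s12, s13, s23, e12]
  · by_cases s13 : c.Step i (i + 2)
    · by_cases s23 : c.Step (i + 1) (i + 2)
      · simp [s12, s13, s23]
      · by_cases e13 : c.Enters i (i + 2) <;> simp [s12, s13, s23, e13]
    · by_cases s23 : c.Step (i + 1) (i + 2)
      · by_cases e23 : c.Enters (i + 1) (i + 2) <;> simp [s12, s13, s23, e23]
      · simp [s12, s13, s23]

theorem sum_mult_insert (h : Exchangeable Δ g n i J) :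
    ∑ c ∈ codeFinset Δ g, c.mult n (insert i J) =
      ∑ c ∈ codeFinset Δ g, c.mult n (insert (i + 1) J) := by
  rw [← sub_eq_zero, ← Finset.sum_sub_distrib, ← h.sum_defect]
  exact Finset.sum_congr rfl fun c _ => Code.mult_sub_mult h.one_le h.le_n h.notMem c

end Exchangeable

/-! ### Pairings -/

/-- `I` is the set of the smallest elements of the pairs of a pairing of `{1, …, n}`. -/
structure IsSparse (n : ℕ) (I : Finset ℕ) : Prop where
  bounds : ∀ i ∈ I, 1 ≤ i ∧ i + 1 ≤ n
  succ_notMem : ∀ i ∈ I, i + 1 ∉ I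

theorem pair_injective : Function.Injective fun i : ℕ => ({i, i + 1} : Finset ℕ) := by
  intro i j h
  have h1 : i ∈ ({j, j + 1} : Finset ℕ) := by
    rw [← show ({i, i + 1} : Finset ℕ) = {j, j + 1} from h]
    simp
  have h2 : j ∈ ({i, i + 1} : Finset ℕ) := by
    rw [show ({i, i + 1} : Finset ℕ) = {j, j + 1} from h]
    simp
  simp only [Finset.mem_insert, Finset.mem_singleton] at h1 h2
  omega

theorem IsPairing.exists_sparse {n s : ℕ} {S : Finset (Finset ℕ)} (h : IsPairing n s S) :
    ∃ I, IsSparse n I ∧ I.card = s ∧ pairs I = S := by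
  obtain ⟨hcard, hpair, hdisj⟩ := h
  set I := (Finset.range (n + 1)).filter fun i => ({i, i + 1} : Finset ℕ) ∈ S with hI
  have hmem : ∀ i ∈ I, ({i, i + 1} : Finset ℕ) ∈ S := fun i hi => (Finset.mem_filter.1 hi).2
  have hS : pairs I = S := by
    ext α
    constructor
    · intro hα
      obtain ⟨i, hi, rfl⟩ := Finset.mem_image.1 hα
      exact hmem i hi
    · intro hα
      obtain ⟨i, h1, h2, rfl⟩ := hpair α hα
      exact Finset.mem_image.2 ⟨i, Finset.mem_filter.2 ⟨Finset.mem_range.2 (by omega), hα⟩, rfl⟩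
  refine ⟨I, ⟨fun i hi => ?_, fun i hi hi' => ?_⟩, ?_, hS⟩
  · obtain ⟨j, h1, h2, h3⟩ := hpair _ (hmem i hi)
    have : i = j := pair_injective h3
    omega
  · have h1 := hdisj _ (hmem i hi) _ (hmem _ hi') fun h => by
      have := pair_injective h
      omega
    exact Finset.disjoint_left.1 h1 (show i + 1 ∈ _ by simp) (by simp)
  · rw [← hcard, ← hS, pairs, Finset.card_image_of_injective _ pair_injective]

/-- The set `{1, 3, …, 2 s - 1}`. -/
def oddSet (s : ℕ) : Finset ℕ := (Finset.range s).image fun k => 2 * k + 1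

/-- `hI` says that no pair can move to the left: it starts at `1` or touches the preceding pair. The
condition `1 ≤ i` guards the truncated subtraction. -/
theorem eq_oddSet {n : ℕ} {I : Finset ℕ} (h : IsSparse n I)
    (hI : ∀ i, i + 1 ∈ I → i = 0 ∨ (1 ≤ i ∧ i - 1 ∈ I)) : I = oddSet I.card := by
  have hodd : ∀ i ∈ I, ∃ k, i = 2 * k + 1 ∧ ∀ l ≤ k, 2 * l + 1 ∈ I := by
    intro i
    induction i using Nat.strong_induction_on with
    | _ i ih =>
      intro hi
      have h1 := (h.bounds i hi).1
      obtain ⟨j, rfl⟩ : ∃ j, i = j + 1 := ⟨i - 1, by omega⟩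
      rcases hI j hi with rfl | ⟨hj, hj'⟩
      · refine ⟨0, rfl, fun l hl => ?_⟩
        obtain rfl : l = 0 := by omega
        exact hi
      · obtain ⟨k, hk, hk'⟩ := ih (j - 1) (by omega) hj'
        refine ⟨k + 1, by omega, fun l hl => ?_⟩
        rcases Nat.lt_or_ge k l with hlk | hlk
        · obtain rfl : l = k + 1 := by omega
          rwa [show 2 * (k + 1) + 1 = j + 1 by omega]
        · exact hk' l hlk
  have hinj : Function.Injective fun k : ℕ => 2 * k + 1 := fun a b hab => by
    simp only at hab
    omega
  refine Finset.eq_of_subset_of_card_le ?_ ?_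
  · intro i hi
    obtain ⟨k, rfl, hk⟩ := hodd i hi
    refine Finset.mem_image.2 ⟨k, Finset.mem_range.2 ?_, rfl⟩
    have hsub : (Finset.range (k + 1)).image (fun k => 2 * k + 1) ⊆ I := by
      intro x hx
      obtain ⟨l, hl, rfl⟩ := Finset.mem_image.1 hx
      exact hk l (by simpa [Nat.lt_succ_iff] using hl)
    have := Finset.card_le_card hsub
    rw [Finset.card_image_of_injective _ hinj, Finset.card_range] at this
    omega
  · rw [oddSet, Finset.card_image_of_injective _ hinj, Finset.card_range]

/-- A function on pairings that is invariant under moving one pair by one step is constant on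
pairings of the same order. -/
theorem eq_oddSet_of_invariant {α : Type*} {n : ℕ} (F : Finset ℕ → α)
    (hF : ∀ (i : ℕ) (J : Finset ℕ), 1 ≤ i → i + 2 ≤ n → (∀ j ∈ J, j + 1 < i ∨ i + 2 < j) →
      F (insert i J) = F (insert (i + 1) J)) {I : Finset ℕ} (hI : IsSparse n I) :
    F I = F (oddSet I.card) := by
  -- Each move to the left lowers the sum of the starting positions by one, which makes the descent
  -- terminate.
  generalize hN : ∑ i ∈ I, i = N
  induction N using Nat.strong_induction_on generalizing I with
  | _ N ih =>
    by_cases hstuck : ∀ i, i + 1 ∈ I → i = 0 ∨ (1 ≤ i ∧ i - 1 ∈ I)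
    · rw [← eq_oddSet hI hstuck]
    push Not at hstuck
    obtain ⟨i, hi, hi0, hi'⟩ := hstuck
    have hi1 : 1 ≤ i := by omega
    have hpred := hi' hi1
    set J := I.erase (i + 1) with hJ
    have hIJ : insert (i + 1) J = I := Finset.insert_erase hi
    have hJ' : ∀ j ∈ J, j + 1 < i ∨ i + 2 < j := by
      intro j hj
      obtain ⟨h1, h2⟩ := Finset.mem_erase.1 hj
      have h3 : j ≠ i := fun h => hI.succ_notMem j h2 (by rwa [h])
      have h4 : j ≠ i + 2 := fun h => hI.succ_notMem (i + 1) hi (by rwa [← h])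
      have h5 : j ≠ i - 1 := fun h => hpred (by rwa [← h])
      omega
    have hn : i + 2 ≤ n := (hI.bounds _ hi).2
    have hiJ : i ∉ J := fun h => by
      have := hJ' i h
      omega
    have hsp : IsSparse n (insert i J) := by
      constructor
      · intro j hj
        rcases Finset.mem_insert.1 hj with rfl | hj
        · omega
        · exact hI.bounds j (Finset.mem_of_mem_erase hj)
      · intro j hj hj'
        rcases Finset.mem_insert.1 hj with rfl | hj <;>
          rcases Finset.mem_insert.1 hj' with h | hj'
        · omega
        · have := hJ' _ hj'
          omega
        · have := hJ' _ hj
          omega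
        · exact hI.succ_notMem j (Finset.mem_of_mem_erase hj) (Finset.mem_of_mem_erase hj')
    have hcard : (insert i J).card = I.card := by
      rw [Finset.card_insert_of_notMem hiJ, Finset.card_erase_add_one hi]
    have hsum : ∑ j ∈ insert i J, j < N := by
      rw [Finset.sum_insert hiJ, ← hN, ← Finset.add_sum_erase I (fun j => j) hi, ← hJ]
      omega
    have := ih _ hsum hsp rfl
    rw [← hIJ, ← hF i J hi1 hn hJ', this, hcard, hIJ]

/-- The invariance of the sum of the refined multiplicities. -/
theorem finite_and_mem_and_eq {Δ : Set (ℝ × ℝ)} (hΔ : IsLatticePolygon Δ) (g s : ℕ)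
    (S S' : Finset (Finset ℕ)) (hS : IsPairing (boundaryPoints Δ - 1 + g) s S)
    (hS' : IsPairing (boundaryPoints Δ - 1 + g) s S') :
    Finite (MarkedClass Δ g) ∧ G g Δ S ∈ laurentQ ∧ G g Δ S = G g Δ S' := by
  refine ⟨markedClass_finite Δ g, ?_⟩
  -- Without any diagram both sums are empty. Otherwise one diagram `D₀` provides the common number
  -- of elements.
  by_cases hne : Nonempty (MarkedFloorDiagram Δ g)
  swap
  · rw [not_nonempty_iff] at hne
    have : IsEmpty (MarkedClass Δ g) := ⟨fun c => Quotient.inductionOn c fun D => hne.false D⟩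
    have hG : ∀ S, G g Δ S = 0 := fun S => finsum_of_isEmpty _
    rw [hG, hG]
    exact ⟨zero_mem _, rfl⟩
  obtain ⟨D₀⟩ := hne
  have hn : ∀ D : MarkedFloorDiagram Δ g, D.numElts = D₀.numElts := fun D =>
    D.numElts_eq D₀.toFloorDiagram
  have hle := D₀.boundaryPoints_le_numElts hΔ
  have hsum : ∀ S, IsPairing (boundaryPoints Δ - 1 + g) s S → G g Δ S ∈ laurentQ ∧
      G g Δ S = ∑ c ∈ codeFinset Δ g, c.mult D₀.numElts (oddSet s) := by
    intro S hS
    obtain ⟨I, hI, rfl, rfl⟩ := hS.exists_sparse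
    have hI' : IsSparse D₀.numElts I :=
      ⟨fun i hi => ⟨(hI.bounds i hi).1, (hI.bounds i hi).2.trans hle⟩, hI.succ_notMem⟩
    have hG := G_eq_sum hI'.succ_notMem hI'.bounds hn
    refine ⟨?_, hG.trans ?_⟩
    · rw [hG]
      exact sum_mem fun c _ => c.mult_mem _ _
    · exact eq_oddSet_of_invariant
        (fun I => ∑ c ∈ codeFinset Δ g, c.mult D₀.numElts I)
        (fun i J h1 h2 h3 => Exchangeable.sum_mult_insert ⟨hn, h1, h2, h3⟩) hI'
  exact ⟨(hsum S hS).1, (hsum S hS).2.trans (hsum S' hS').2.symm⟩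

end FloorDiagrams

end

theorem theorem3p3 (Δ : Set (ℝ × ℝ)) (hΔ : FloorDiagrams.IsHTransverse Δ) (g s : ℕ)
    (S S' : Finset (Finset ℕ))
    (hS : FloorDiagrams.IsPairing (FloorDiagrams.boundaryPoints Δ - 1 + g) s S)
    (hS' : FloorDiagrams.IsPairing (FloorDiagrams.boundaryPoints Δ - 1 + g) s S') :
    Finite (FloorDiagrams.MarkedClass Δ g) ∧
      FloorDiagrams.G g Δ S ∈ FloorDiagrams.laurentQ ∧
      FloorDiagrams.G g Δ S = FloorDiagrams.G g Δ S' := by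
  exact FloorDiagrams.finite_and_mem_and_eq hΔ.1 g s S S' hS hS'
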